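/- **Theorem.** Let $M$ be a nonempty closed (i.e. compact, without boundary) smooth manifold of dimension $n$, let $J\subseteq\mathbb R$ be an interval with least element $0$ (for example $J=[0,T)$ with $0<T\le\infty$), and let $g(t)$, $t\in J$, be a smooth solution of the Ricci flow on $M$: a family of Riemannian metrics whose local components $g_{ij}(x,t)$ are smooth on $M\times J$ and satisfy $$\frac{\partial}{\partial t}g_{ij}=-2\,\mathrm{Ric}_{ij}$$ (with one-sided derivatives at end points of $J$). Here $\mathrm{Ric}$ is the Ricci curvature of $g(t)$, with the sign for which round spheres have positive Ricci curvature. Let $R(x,t)=g^{ij}\mathrm{Ric}_{ij}$ be the scalar curvature of $g(t)$ at $x$. Then $m:=\min_{x\in M}R(x,0)$ exists, and the following hold. 1. If $m\neq 0$, then for all $x\in M$ and $t\in J$ we have $\frac1m-\frac{2}{n}t\neq 0$ and $$R(x,t)\ \ge\ \left(\frac{1}{m}-\frac{2}{n}\,t\right)^{-1}.$$ 2. If $m=0$, then $R(x,t)\ge 0$ for all $x\in M$ and $t\in J$. -/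

import Mathlib

open scoped Manifold ContDiff

noncomputable section

namespace RicciFlow

/-- The model space `ℝⁿ`. -/
abbrev Model (n : ℕ) : Type := EuclideanSpace ℝ (Fin n)

/-! ### Curvature of a matrix field `(g_{ij})` on a region of `ℝⁿ` -/

section Local

variable {n : ℕ}

/-- The partial derivative `∂f/∂xⁱ` at the point `y`. -/
def partialDeriv (i : Fin n) (f : Model n → ℝ) (y : Model n) : ℝ :=
  fderiv ℝ f y (EuclideanSpace.single i 1)

/-- The Christoffel symbol
`Γᵏ_{ij} = ½ ∑ₗ gᵏˡ (∂ᵢ g_{jl} + ∂ⱼ g_{il} - ∂ₗ g_{ij})` of the Levi-Civita connection,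
where `(gᵏˡ)` is the inverse matrix of `(g_{kl})`. -/
def christoffel (G : Model n → Matrix (Fin n) (Fin n) ℝ) (k i j : Fin n) (y : Model n) : ℝ :=
  (1 / 2) * ∑ l, (G y)⁻¹ k l *
    (partialDeriv i (fun z => G z j l) y + partialDeriv j (fun z => G z i l) y
      - partialDeriv l (fun z => G z i j) y)

/-- The component `R_{ijk}ˡ` of the curvature tensor, `R(∂ᵢ, ∂ⱼ)∂ₖ = ∑ₗ R_{ijk}ˡ ∂ₗ` with
`R(X, Y)Z = ∇_X ∇_Y Z - ∇_Y ∇_X Z - ∇_{[X, Y]} Z`. -/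
def riemann (G : Model n → Matrix (Fin n) (Fin n) ℝ) (i j k l : Fin n) (y : Model n) : ℝ :=
  partialDeriv i (christoffel G l j k) y - partialDeriv j (christoffel G l i k) y
    + ∑ m, (christoffel G m j k y * christoffel G l i m y
      - christoffel G m i k y * christoffel G l j m y)

/-- The component `Ric_{jk}` of the Ricci tensor, the trace of `Z ↦ R(Z, ∂ⱼ)∂ₖ`
(so that round spheres have positive Ricci curvature). -/
def ricci (G : Model n → Matrix (Fin n) (Fin n) ℝ) (j k : Fin n) (y : Model n) : ℝ :=
  ∑ i, riemann G i j k i y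

/-- The scalar curvature `gʲᵏ Ric_{jk}`. -/
def scal (G : Model n → Matrix (Fin n) (Fin n) ℝ) (y : Model n) : ℝ :=
  ∑ j, ∑ k, (G y)⁻¹ j k * ricci G j k y

end Local

/-! ### Riemannian metrics on a smooth manifold -/

section Global

variable (n : ℕ) (M : Type*) [TopologicalSpace M] [ChartedSpace (Model n) M]
  [IsManifold (𝓡 n) ∞ M]

/-- Smooth Riemannian metrics on the smooth `n`-manifold `M` (without boundary). -/
abbrev Metric : Type _ :=
  Bundle.ContMDiffRiemannianMetric (𝓡 n) ∞ (Model n) (fun x : M => TangentSpace (𝓡 n) x)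

variable {n M}

/-- The coordinate vector field `∂ᵢ` of the chart around `p`, at the point with coordinates `y`. -/
def coordVec (p : M) (i : Fin n) (y : Model n) :
    TangentSpace (𝓡 n) ((extChartAt (𝓡 n) p).symm y) :=
  mfderiv 𝓘(ℝ, Model n) (𝓡 n) (extChartAt (𝓡 n) p).symm y (EuclideanSpace.single i 1)

/-- The matrix `g_{ij} = g(∂ᵢ, ∂ⱼ)` of the metric in the chart around `p`, as a function of the
coordinates `y` (meaningful for `y` in the open set `(extChartAt (𝓡 n) p).target`). -/
def Metric.coord (g : Metric n M) (p : M) (y : Model n) : Matrix (Fin n) (Fin n) ℝ :=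
  Matrix.of fun i j =>
    g.inner ((extChartAt (𝓡 n) p).symm y) (coordVec p i y) (coordVec p j y)

/-- The scalar curvature `R` of `(M, g)` at the point `x`, computed in the chart around `x`. -/
def Metric.scalarCurvature (g : Metric n M) (x : M) : ℝ :=
  scal (g.coord x) (extChartAt (𝓡 n) x x)

/-- A smooth solution `g(t)`, `t ∈ J`, of the Ricci flow `∂g/∂t = -2 Ric` on `M`: in local
coordinates around every point, the components `g_{ij}(y, t)` are smooth functions of `(t, y)`
and satisfy `∂g_{ij}/∂t = -2 Ric_{ij}` (one-sided derivatives at end points of `J`). -/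
structure IsRicciFlow (J : Set ℝ) (g : ℝ → Metric n M) : Prop where
  smooth : ∀ (p : M) (i j : Fin n),
    ContDiffOn ℝ ∞ (fun q : ℝ × Model n => (g q.1).coord p q.2 i j)
      (J ×ˢ (extChartAt (𝓡 n) p).target)
  evolution : ∀ (p : M), ∀ t ∈ J, ∀ y ∈ (extChartAt (𝓡 n) p).target, ∀ i j : Fin n,
    HasDerivWithinAt (fun s => (g s).coord p y i j) (-2 * ricci ((g t).coord p) i j y) J t

end Global

end RicciFlow

end

/-! Under the Ricci flow the scalar curvature satisfies ∂R/∂t = ΔR + 2|Ric|² (`scalar_evolution`),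
and Cauchy–Schwarz gives |Ric|² ≥ R²/n (`contr_sq_le`). At a spatial minimum ΔR ≥ 0, so there ∂R/∂t
≥ (2/n)R² (`scal_evolution_at_min`). On a compact manifold the minimum principle (`min_principle`)
then keeps R above the solution of ρ' = (2/n)ρ², ρ(0) = m, which is (1/m - 2t/n)⁻¹, or 0 if m = 0.
For m < 0 the number 1/m - 2t/n stays negative. For m > 0 it vanishes at t = n/(2m), but the flow
cannot last that long: ρ would exceed any bound before that time, while R at a fixed point is
bounded on a compact time interval (`IsRicciFlow.comparison_pos`).

The evolution equation is a formal identity: it uses only the Leibniz rule, the commutation of the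
derivatives in space and time, the symmetry and invertibility of g, and the flow equation. It is
therefore proved as matrix algebra over an abstract commutative ring with commuting derivations. The
Palatini identity writes the contracted variation of Ric as a divergence, and the contracted second
Bianchi identity identifies the vector field in it with ∇R. The ring is afterwards specialised to
smooth functions on J × U, with derivatives taken within this set, so that end points of J need no
separate treatment.

The scalar curvature at x is defined in the chart around x. To treat R as a function near a point
one needs its coordinate invariance (`scalar_pullback`, `scal_comp`): the pulled back connection,
gauge transformed by the Jacobian, is torsion free and metric, hence is the Levi-Civita connection
of the pulled back metric, and curvature is conjugated under gauge transformations. -/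

noncomputable section

namespace RicciFlow

set_option linter.unusedSectionVars false

/-! ### Levi-Civita calculus over a differential ring -/

section DifferentialRing

variable {ι A : Type*} [Fintype ι] [DecidableEq ι] [CommRing A] [Algebra ℝ A]

/-- Entrywise application of a derivation to a matrix. -/
def matDeriv (δ : Derivation ℝ A A) (M : Matrix ι ι A) : Matrix ι ι A := M.map δ

@[simp] theorem matDeriv_apply (δ : Derivation ℝ A A) (M : Matrix ι ι A) (i j : ι) :
    matDeriv δ M i j = δ (M i j) := rfl

theorem matDeriv_add (δ : Derivation ℝ A A) (M N : Matrix ι ι A) :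
    matDeriv δ (M + N) = matDeriv δ M + matDeriv δ N := by
  ext i j; simp

theorem matDeriv_sub (δ : Derivation ℝ A A) (M N : Matrix ι ι A) :
    matDeriv δ (M - N) = matDeriv δ M - matDeriv δ N := by
  ext i j; simp

theorem matDeriv_neg (δ : Derivation ℝ A A) (M : Matrix ι ι A) :
    matDeriv δ (-M) = -matDeriv δ M := by
  ext i j; simp

theorem matDeriv_mul (δ : Derivation ℝ A A) (M N : Matrix ι ι A) :
    matDeriv δ (M * N) = matDeriv δ M * N + M * matDeriv δ N := by
  ext i j
  simp only [matDeriv_apply, Matrix.mul_apply, map_sum, Derivation.leibniz, smul_eq_mul,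
    Matrix.add_apply, ← Finset.sum_add_distrib]
  exact Finset.sum_congr rfl fun _ _ => by ring

theorem matDeriv_transpose (δ : Derivation ℝ A A) (M : Matrix ι ι A) :
    matDeriv δ M.transpose = (matDeriv δ M).transpose := rfl

theorem matDeriv_one (δ : Derivation ℝ A A) : matDeriv δ (1 : Matrix ι ι A) = 0 := by
  ext i j
  by_cases h : i = j
  · simp [h]
  · simp [h]

theorem matDeriv_inv (δ : Derivation ℝ A A) {g : Matrix ι ι A} (hg : IsUnit g.det) :
    matDeriv δ g⁻¹ = -(g⁻¹ * matDeriv δ g * g⁻¹) := by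
  have h := matDeriv_mul δ g⁻¹ g
  rw [Matrix.nonsing_inv_mul _ hg, matDeriv_one] at h
  have h2 : (matDeriv δ g⁻¹ * g) * g⁻¹ = -(g⁻¹ * matDeriv δ g) * g⁻¹ := by
    rw [eq_neg_of_add_eq_zero_left h.symm]
  rwa [Matrix.mul_assoc, Matrix.mul_nonsing_inv _ hg, Matrix.mul_one, neg_mul] at h2

/-- The coefficient matrices `(Γᵢ)ᵏⱼ = Γᵏᵢⱼ` of the Levi-Civita connection of `g`. -/
def conn (D : ι → Derivation ℝ A A) (g : Matrix ι ι A) (i : ι) : Matrix ι ι A :=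
  Matrix.of fun k j =>
    (1 / 2 : ℝ) • ∑ l, g⁻¹ k l * (D i (g j l) + D j (g i l) - D l (g i j))

/-- The curvature matrices `∂ᵢΓⱼ - ∂ⱼΓᵢ + [Γᵢ, Γⱼ]` of a connection. -/
def curv (D : ι → Derivation ℝ A A) (Γ : ι → Matrix ι ι A) (i j : ι) : Matrix ι ι A :=
  matDeriv (D i) (Γ j) - matDeriv (D j) (Γ i) + (Γ i * Γ j - Γ j * Γ i)

/-- The Ricci matrix of a connection. -/
def ric (D : ι → Derivation ℝ A A) (Γ : ι → Matrix ι ι A) : Matrix ι ι A :=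
  Matrix.of fun j k => ∑ i, curv D Γ i j i k

/-- The full contraction `∑ Hⱼₖ Sⱼₖ` of two matrices. -/
def contr (H S : Matrix ι ι A) : A := ∑ j, ∑ k, H j k * S j k

variable {D : ι → Derivation ℝ A A} {g : Matrix ι ι A}

/-- Lowering the index removes g⁻¹ from the Christoffel formula; the arguments about the connection
go through this form. -/
theorem mul_conn_apply (D : ι → Derivation ℝ A A) (hg : IsUnit g.det) (i l j : ι) :
    (g * conn D g i) l j = (1 / 2 : ℝ) • (D i (g j l) + D j (g i l) - D l (g i j)) := by
  have h : conn D g i = g⁻¹ * Matrix.of fun l j =>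
      (1 / 2 : ℝ) • (D i (g j l) + D j (g i l) - D l (g i j)) := by
    ext k j
    simp [conn, Matrix.mul_apply, Finset.smul_sum]
  rw [h, ← Matrix.mul_assoc, Matrix.mul_nonsing_inv _ hg, Matrix.one_mul, Matrix.of_apply]

theorem conn_symm (D : ι → Derivation ℝ A A) (hs : g.transpose = g) (i j k : ι) :
    conn D g i k j = conn D g j k i := by
  have hs' : ∀ a b, g a b = g b a := fun a b => congrFun (congrFun hs b) a
  simp only [conn, Matrix.of_apply]
  congr 1
  refine Finset.sum_congr rfl fun l _ => ?_
  rw [hs' i j]; ring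

theorem half_smul_eq {x y : A} (h : y = x + x) : (1 / 2 : ℝ) • y = x := by
  rw [h, ← two_smul ℝ x, smul_smul]; norm_num

/-- Metric compatibility: in the lowered symbols symmetrised over the last two indices, all terms
but the derivative of g in direction i cancel. -/
theorem deriv_metric (D : ι → Derivation ℝ A A) (hg : IsUnit g.det) (hs : g.transpose = g)
    (i : ι) :
    matDeriv (D i) g = g * conn D g i + (conn D g i).transpose * g := by
  have hs' : ∀ a b, g a b = g b a := fun a b => congrFun (congrFun hs b) a
  have h : (conn D g i).transpose * g = (g * conn D g i).transpose := by
    rw [Matrix.transpose_mul, hs]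
  rw [h]
  ext a b
  rw [Matrix.add_apply, Matrix.transpose_apply, mul_conn_apply D hg, mul_conn_apply D hg,
    ← smul_add, matDeriv_apply, hs' b a, hs' i a, hs' i b]
  refine (half_smul_eq ?_).symm
  rw [hs' a i, hs' b i]
  abel

/-- Uniqueness of the Levi-Civita connection. -/
theorem conn_unique (hg : IsUnit g.det) (hs : g.transpose = g) {Γ : ι → Matrix ι ι A}
    (hΓ : ∀ i j k, Γ i k j = Γ j k i)
    (hc : ∀ i, matDeriv (D i) g = g * Γ i + (g * Γ i).transpose) (i : ι) :
    Γ i = conn D g i := by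
  have hs' : ∀ a b, g a b = g b a := fun a b => congrFun (congrFun hs b) a
  have hL : ∀ i j l, (g * Γ i) l j = (g * Γ j) l i := fun i j l => by
    simp only [Matrix.mul_apply, hΓ i j]
  have hc' : ∀ i a b, D i (g a b) = (g * Γ i) a b + (g * Γ i) b a := fun i a b => by
    rw [← matDeriv_apply, hc]; rfl
  -- Koszul's argument: the alternating sum of three compatibility equations, with `hL` (vanishing
  -- torsion), leaves twice one lowered symbol.
  have h : g * Γ i = g * conn D g i := by
    ext l j
    rw [mul_conn_apply D hg, hc', hc', hc', hL l i j, hL l j i, hL j i l]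
    refine (half_smul_eq ?_).symm
    abel
  have h2 := congrArg (g⁻¹ * ·) h
  simpa only [← Matrix.mul_assoc, Matrix.nonsing_inv_mul _ hg, Matrix.one_mul] using h2

theorem inv_transpose_self (hs : g.transpose = g) : (g⁻¹).transpose = g⁻¹ := by
  rw [Matrix.transpose_nonsing_inv, hs]

theorem deriv_inv_metric (D : ι → Derivation ℝ A A) (hg : IsUnit g.det)
    (hs : g.transpose = g) (i : ι) :
    matDeriv (D i) g⁻¹ = -(conn D g i * g⁻¹ + g⁻¹ * (conn D g i).transpose) := by
  rw [matDeriv_inv _ hg, deriv_metric D hg hs]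
  congr 1
  rw [Matrix.mul_add, Matrix.add_mul, ← Matrix.mul_assoc, Matrix.nonsing_inv_mul _ hg,
    Matrix.one_mul, Matrix.mul_assoc, Matrix.mul_assoc, Matrix.mul_nonsing_inv _ hg,
    Matrix.mul_one]

theorem curv_swap (Γ : ι → Matrix ι ι A) (i j : ι) : curv D Γ i j = -curv D Γ j i := by
  unfold curv; abel

theorem matDeriv_comm (hD : ∀ i j a, D i (D j a) = D j (D i a)) (i j : ι) (M : Matrix ι ι A) :
    matDeriv (D i) (matDeriv (D j) M) = matDeriv (D j) (matDeriv (D i) M) := by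
  ext a b; exact hD _ _ _

/-- The curvature of a metric connection is skew. -/
theorem curv_skew (hD : ∀ i j a, D i (D j a) = D j (D i a)) (hg : IsUnit g.det)
    (hs : g.transpose = g) (i j : ι) :
    g * curv D (conn D g) i j + (curv D (conn D g) i j).transpose * g = 0 := by
  -- The commutator of two derivatives annihilates g; expanding it by metric compatibility twice
  -- produces exactly the symmetrised curvature.
  have h := matDeriv_comm hD i j g
  have hi := deriv_metric D hg hs i
  have hj := deriv_metric D hg hs j
  rw [hi, hj] at h
  simp only [matDeriv_add, matDeriv_mul, matDeriv_transpose, hi, hj] at h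
  unfold curv
  simp only [Matrix.transpose_add, Matrix.transpose_sub, Matrix.transpose_mul]
  rw [← sub_eq_zero] at h
  rw [← h]
  noncomm_ring

theorem curv_mul_inv_skew (hD : ∀ i j a, D i (D j a) = D j (D i a)) (hg : IsUnit g.det)
    (hs : g.transpose = g) (i j : ι) :
    curv D (conn D g) i j * g⁻¹ + g⁻¹ * (curv D (conn D g) i j).transpose = 0 := by
  have h := congrArg (fun X => g⁻¹ * X * g⁻¹) (curv_skew hD hg hs i j)
  simp only [Matrix.mul_add, Matrix.add_mul, Matrix.mul_zero, Matrix.zero_mul] at h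
  rw [← Matrix.mul_assoc, Matrix.nonsing_inv_mul _ hg, Matrix.one_mul, Matrix.mul_assoc,
    Matrix.mul_assoc, Matrix.mul_nonsing_inv _ hg, Matrix.mul_one] at h
  exact h

/-- The covariant derivative `∇ₐ R_{bc}` of the curvature. -/
def covCurv (D : ι → Derivation ℝ A A) (Γ : ι → Matrix ι ι A) (a b c : ι) : Matrix ι ι A :=
  matDeriv (D a) (curv D Γ b c) + (Γ a * curv D Γ b c - curv D Γ b c * Γ a)
    - ∑ m, Γ a m b • curv D Γ m c - ∑ m, Γ a m c • curv D Γ b m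

/-- The covariant derivative of a field of bilinear forms. -/
def covBilin (D : ι → Derivation ℝ A A) (Γ : ι → Matrix ι ι A) (a : ι) (S : Matrix ι ι A) :
    Matrix ι ι A :=
  matDeriv (D a) S - (Γ a).transpose * S - S * Γ a

theorem covCurv_swap (Γ : ι → Matrix ι ι A) (a b c : ι) :
    covCurv D Γ a b c = -covCurv D Γ a c b := by
  unfold covCurv
  have h : ∀ m, curv D Γ m c = -curv D Γ c m := fun m => curv_swap _ _ _
  have h' : ∀ m, curv D Γ b m = -curv D Γ m b := fun m => curv_swap _ _ _
  simp only [h b, matDeriv_neg, h, h', smul_neg, Finset.sum_neg_distrib]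
  noncomm_ring

/-- Vanishing torsion makes the corrections for the two form indices cancel in pairs over the cyclic
sum. What is left is the Jacobi identity for the operators ∂ₐ + Γₐ. -/
theorem second_bianchi (hD : ∀ i j a, D i (D j a) = D j (D i a)) {Γ : ι → Matrix ι ι A}
    (hΓ : ∀ i j k, Γ i k j = Γ j k i) (a b c : ι) :
    covCurv D Γ a b c + covCurv D Γ b c a + covCurv D Γ c a b = 0 := by
  have e : ∀ x y z, ∑ m, Γ x m y • curv D Γ m z = -∑ m, Γ y m x • curv D Γ z m := by
    intro x y z
    rw [← Finset.sum_neg_distrib]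
    refine Finset.sum_congr rfl fun m _ => ?_
    rw [hΓ x y, curv_swap, smul_neg]
  unfold covCurv
  rw [e a b c, e b c a, e c a b]
  unfold curv
  simp only [matDeriv_add, matDeriv_sub, matDeriv_mul]
  rw [matDeriv_comm hD b a, matDeriv_comm hD c a, matDeriv_comm hD c b]
  noncomm_ring

/-- Skewness survives covariant differentiation because g⁻¹ is parallel: one differentiates
`curv_mul_inv_skew` and absorbs the derivatives of g⁻¹ into the commutators with Γ. -/
theorem covCurv_mul_inv_skew (hD : ∀ i j a, D i (D j a) = D j (D i a)) (hg : IsUnit g.det)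
    (hs : g.transpose = g) (a b c : ι) :
    covCurv D (conn D g) a b c * g⁻¹ + g⁻¹ * (covCurv D (conn D g) a b c).transpose = 0 := by
  set Γ := conn D g with hΓ
  set H := g⁻¹ with hH
  have hR : ∀ x y, curv D Γ x y * H + H * (curv D Γ x y).transpose = 0 :=
    curv_mul_inv_skew hD hg hs
  have h1 := congrArg (matDeriv (D a)) (hR b c)
  have h0 : matDeriv (D a) (0 : Matrix ι ι A) = 0 := by ext; simp
  simp only [matDeriv_add, matDeriv_mul, matDeriv_transpose, h0, hH,
    deriv_inv_metric D hg hs] at h1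
  rw [← hH, ← hΓ] at h1
  have hsum : ∀ (f : ι → A) (S : ι → Matrix ι ι A),
      (∀ m, S m * H + H * (S m).transpose = 0) →
      (∑ m, f m • S m) * H + H * (∑ m, f m • S m).transpose = 0 := by
    intro f S hS
    rw [Matrix.transpose_sum, Finset.sum_mul, Finset.mul_sum, ← Finset.sum_add_distrib]
    refine Finset.sum_eq_zero fun m _ => ?_
    rw [Matrix.transpose_smul, Matrix.smul_mul, Matrix.mul_smul, ← smul_add, hS, smul_zero]
  have hs1 := hsum (fun m => Γ a m b) (fun m => curv D Γ m c) fun m => hR m c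
  have hs2 := hsum (fun m => Γ a m c) (fun m => curv D Γ b m) fun m => hR b m
  have h2 := hR b c
  unfold covCurv
  simp only [Matrix.transpose_add, Matrix.transpose_sub, Matrix.transpose_mul]
  generalize (∑ m, Γ a m b • curv D Γ m c) = S1 at *
  generalize (∑ m, Γ a m c • curv D Γ b m) = S2 at *
  generalize curv D Γ b c = R at *
  generalize hT : Γ a = T at *
  have h3 : (R * H + H * R.transpose) * T.transpose
      + T * (R * H + H * R.transpose) = 0 := by rw [h2]; simp
  calc _ = (matDeriv (D a) R * H + R * -(T * H + H * T.transpose) +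
        (-(T * H + H * T.transpose) * R.transpose + H * (matDeriv (D a) R).transpose))
        + ((R * H + H * R.transpose) * T.transpose + T * (R * H + H * R.transpose))
        - (S1 * H + H * S1.transpose) - (S2 * H + H * S2.transpose) := by noncomm_ring
    _ = 0 := by rw [h1, h3, hs1, hs2]; simp

/-- Contraction commutes with covariant differentiation: the Γ-terms of the upper and of the lower
contracted index cancel. -/
theorem trace_covCurv (Γ : ι → Matrix ι ι A) (w c k : ι) :
    ∑ a, covCurv D Γ w a c a k = covBilin D Γ w (ric D Γ) c k := by
  simp only [covCurv, covBilin, ric, Matrix.sub_apply, Matrix.add_apply, Matrix.mul_apply,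
    matDeriv_apply, Matrix.transpose_apply, Matrix.of_apply, Matrix.sum_apply, Matrix.smul_apply,
    smul_eq_mul, Finset.sum_sub_distrib, Finset.sum_add_distrib, map_sum, Finset.mul_sum,
    Finset.sum_mul]
  have e1 : ∑ x, ∑ j, Γ w x j * curv D Γ x c j k = ∑ x, ∑ m, Γ w m x * curv D Γ m c x k :=
    Finset.sum_comm
  have e2 : ∑ x, ∑ m, Γ w m c * curv D Γ x m x k = ∑ m, ∑ x, Γ w m c * curv D Γ x m x k :=
    Finset.sum_comm
  have e3 : ∑ x, ∑ j, curv D Γ x c x j * Γ w j k = ∑ j, ∑ x, curv D Γ x c x j * Γ w j k :=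
    Finset.sum_comm
  rw [e1, e2, e3]
  abel

/-- Since g⁻¹ is parallel, differentiating the trace of S amounts to tracing the covariant
derivative of S. -/
theorem deriv_contr_inv (D : ι → Derivation ℝ A A) (hg : IsUnit g.det) (hs : g.transpose = g)
    (S : Matrix ι ι A) (l : ι) :
    D l (contr g⁻¹ S) = contr g⁻¹ (covBilin D (conn D g) l S) := by
  have hd := deriv_inv_metric D hg hs l
  have hH : ∀ j k, D l (g⁻¹ j k) = -((∑ m, conn D g l j m * g⁻¹ m k)
      + ∑ m, g⁻¹ j m * conn D g l k m) := fun j k => by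
    have := congrFun (congrFun hd j) k
    simpa [Matrix.mul_apply] using this
  simp only [contr, covBilin, map_sum, Derivation.leibniz, smul_eq_mul, hH, Matrix.sub_apply,
    Matrix.mul_apply, matDeriv_apply, Matrix.transpose_apply, mul_sub, mul_neg, mul_add,
    Finset.sum_add_distrib, Finset.sum_sub_distrib, Finset.sum_neg_distrib, Finset.mul_sum]
  have e1 : ∑ j, ∑ k, ∑ m, S j k * (conn D g l j m * g⁻¹ m k)
      = ∑ j, ∑ k, ∑ m, g⁻¹ j k * (conn D g l m j * S m k) := by
    have : ∀ j, ∑ k, ∑ m, S j k * (conn D g l j m * g⁻¹ m k)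
      = ∑ m, ∑ k, S j k * (conn D g l j m * g⁻¹ m k) := fun j => Finset.sum_comm
    simp only [this]
    rw [Finset.sum_comm]
    refine Finset.sum_congr rfl fun m _ => ?_
    rw [Finset.sum_comm]
    exact Finset.sum_congr rfl fun k _ => Finset.sum_congr rfl fun j _ => by ring
  have e2 : ∑ j, ∑ k, ∑ m, S j k * (g⁻¹ j m * conn D g l k m)
      = ∑ j, ∑ k, ∑ m, g⁻¹ j k * (S j m * conn D g l m k) := by
    refine Finset.sum_congr rfl fun j _ => ?_
    rw [Finset.sum_comm]
    exact Finset.sum_congr rfl fun k _ => Finset.sum_congr rfl fun m _ => by ring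
  rw [e1, e2]
  abel

/-- The contracted second Bianchi identity `∇ᵦ R = 2 gᵏᶜ ∇ᵪ Ricᵦₖ`. -/
theorem contracted_bianchi (hD : ∀ i j a, D i (D j a) = D j (D i a)) (hg : IsUnit g.det)
    (hs : g.transpose = g) (b : ι) :
    D b (contr g⁻¹ (ric D (conn D g)))
      = 2 * ∑ c, ∑ k, g⁻¹ k c * covBilin D (conn D g) c (ric D (conn D g)) b k := by
  rw [deriv_contr_inv D hg hs]
  set Γ := conn D g with hΓ
  set H := g⁻¹ with hH
  have hHs : ∀ i j, H i j = H j i := fun i j =>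
    congrFun (congrFun (inv_transpose_self hs) j) i
  -- The second Bianchi identity is traced twice. The middle term gives -∇R, and each of the other
  -- two gives the divergence of Ric.
  have hb : ∑ c, ∑ k, ∑ a, (covCurv D Γ a b c a k * H k c + covCurv D Γ b c a a k * H k c
      + covCurv D Γ c a b a k * H k c) = 0 := by
    refine Finset.sum_eq_zero fun c _ => Finset.sum_eq_zero fun k _ =>
      Finset.sum_eq_zero fun a _ => ?_
    have := congrFun (congrFun (second_bianchi hD (conn_symm D hs) a b c) a) k
    rw [← add_mul, ← add_mul]
    rw [Matrix.add_apply, Matrix.add_apply] at this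
    rw [this]; simp
  simp only [Finset.sum_add_distrib] at hb
  have t2 : ∑ c, ∑ k, ∑ a, covCurv D Γ b c a a k * H k c
      = -contr H (covBilin D Γ b (ric D Γ)) := by
    unfold contr
    simp only [← Finset.sum_neg_distrib]
    refine Finset.sum_congr rfl fun c _ => Finset.sum_congr rfl fun k _ => ?_
    rw [← trace_covCurv, Finset.mul_sum, ← Finset.sum_neg_distrib]
    refine Finset.sum_congr rfl fun a _ => ?_
    rw [covCurv_swap, Matrix.neg_apply, hHs k c]; ring
  have t3 : ∑ c, ∑ k, ∑ a, covCurv D Γ c a b a k * H k c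
      = ∑ c, ∑ k, H k c * covBilin D Γ c (ric D Γ) b k := by
    refine Finset.sum_congr rfl fun c _ => Finset.sum_congr rfl fun k _ => ?_
    rw [← trace_covCurv, Finset.mul_sum]
    exact Finset.sum_congr rfl fun a _ => mul_comm _ _
  -- Here the trace is over the wrong pair of indices; skewness of ∇Rm with an index raised (`s1`)
  -- moves it to the pair that defines Ric.
  have t1 : ∑ c, ∑ k, ∑ a, covCurv D Γ a b c a k * H k c
      = ∑ c, ∑ k, H k c * covBilin D Γ c (ric D Γ) b k := by
    have s1 : ∀ c a, ∑ k, covCurv D Γ a b c a k * H k c = ∑ k, covCurv D Γ a c b c k * H k a := by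
      intro c a
      have := congrFun (congrFun (covCurv_mul_inv_skew hD hg hs a b c) a) c
      rw [Matrix.add_apply, Matrix.mul_apply, Matrix.mul_apply] at this
      rw [eq_neg_of_add_eq_zero_left this, ← Finset.sum_neg_distrib]
      refine Finset.sum_congr rfl fun k _ => ?_
      rw [covCurv_swap Γ a c b, Matrix.transpose_apply, Matrix.neg_apply, ← hΓ, ← hH, hHs a k]
      ring
    have s2 : ∀ c, ∑ k, ∑ a, covCurv D Γ a b c a k * H k c
        = ∑ a, ∑ k, covCurv D Γ a c b c k * H k a := fun c => by
      rw [Finset.sum_comm]; exact Finset.sum_congr rfl fun a _ => s1 c a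
    simp only [s2]
    rw [Finset.sum_comm]
    refine Finset.sum_congr rfl fun a _ => ?_
    rw [Finset.sum_comm]
    refine Finset.sum_congr rfl fun k _ => ?_
    rw [← trace_covCurv, Finset.mul_sum]
    exact Finset.sum_congr rfl fun c _ => mul_comm _ _
  rw [t1, t2, t3] at hb
  linear_combination -hb

end DifferentialRing

/-! ### Variation of the curvature and the evolution equation of R -/

section Evolution

variable {ι A : Type*} [Fintype ι] [DecidableEq ι] [CommRing A] [Algebra ℝ A]
variable {D : ι → Derivation ℝ A A} {g : Matrix ι ι A}

/-- The vector field `Hʲᵏ Cⁱⱼₖ - Hⁱᵏ Cᵐₘₖ` attached to the variation `C` of a connection. -/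
def palatiniVec (H : Matrix ι ι A) (C : ι → Matrix ι ι A) (i : ι) : A :=
  ∑ j, ∑ k, H j k * C j i k - ∑ k, H i k * ∑ m, C m m k

/-- The Palatini identity: the contracted variation of the Ricci tensor is a divergence. -/
theorem palatini {T : Derivation ℝ A A}
    (hT : ∀ i a, T (D i a) = D i (T a)) (hg : IsUnit g.det) (hs : g.transpose = g) :
    contr g⁻¹ (matDeriv T (ric D (conn D g)))
      = ∑ i, D i (palatiniVec g⁻¹ (fun j => matDeriv T (conn D g j)) i)
        + ∑ i, (∑ m, conn D g m m i) *
            palatiniVec g⁻¹ (fun j => matDeriv T (conn D g j)) i := by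
  have hsym := conn_symm D hs
  have hinv := deriv_inv_metric D hg hs
  have hHs : ∀ i j, g⁻¹ i j = g⁻¹ j i := fun i j =>
    congrFun (congrFun (inv_transpose_self hs) j) i
  set Γ := conn D g with hΓ
  set H := g⁻¹ with hH
  set C : ι → Matrix ι ι A := fun j => matDeriv T (Γ j) with hC
  have hH' : ∀ i j k, D i (H j k) = -((∑ m, Γ i j m * H m k) + ∑ m, H j m * Γ i k m) :=
    fun i j k => by
      have := congrFun (congrFun (hinv i) j) k
      simpa [Matrix.mul_apply] using this
  have hCa : ∀ i j k, T (Γ i j k) = C i j k := fun _ _ _ => rfl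
  have hCs : ∀ i j k, C i k j = C j k i := fun i j k => by
    rw [← hCa, ← hCa, hsym]
  have hric : ∀ j k, T (ric D Γ j k) = ∑ i, (D i (C j i k) - D j (C i i k)
      + ((∑ m, C i i m * Γ j m k + ∑ m, Γ i i m * C j m k)
        - (∑ m, C j i m * Γ i m k + ∑ m, Γ j i m * C i m k))) := by
    intro j k
    simp only [ric, curv, Matrix.of_apply, map_sum, Matrix.add_apply, Matrix.sub_apply,
      map_add, map_sub, matDeriv_apply, hT, hCa, Matrix.mul_apply, Derivation.leibniz, smul_eq_mul]
    refine Finset.sum_congr rfl fun i _ => ?_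
    simp only [Finset.sum_add_distrib, mul_comm]
    abel
  -- Both sides are expanded into the same contractions of C and its derivatives with g⁻¹ and Γ. The
  -- geometric inputs of the comparison are that g⁻¹ is parallel (`hH'`) and that Γ is symmetric (in
  -- `f1`).
  have lhs : contr H (matDeriv T (ric D Γ))
      = (∑ i, ∑ j, ∑ k, H j k * D i (C j i k)) - (∑ j, ∑ k, H j k * D j (∑ i, C i i k))
        + ((∑ j, ∑ k, H j k * ∑ m, (∑ i, C i i m) * Γ j m k)
          + (∑ j, ∑ k, H j k * ∑ i, ∑ m, Γ i i m * C j m k)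
        - (∑ j, ∑ k, H j k * ∑ i, ∑ m, C j i m * Γ i m k)
        - (∑ j, ∑ k, H j k * ∑ i, ∑ m, Γ j i m * C i m k)) := by
    have e1 : ∑ i, ∑ j, ∑ k, H j k * D i (C j i k) = ∑ j, ∑ k, H j k * ∑ i, D i (C j i k) := by
      simp only [Finset.mul_sum]
      rw [Finset.sum_comm]
      exact Finset.sum_congr rfl fun j _ => Finset.sum_comm
    have e2 : ∀ j k, ∑ i, ∑ m, C i i m * Γ j m k = ∑ m, (∑ i, C i i m) * Γ j m k := fun j k => by
      rw [Finset.sum_comm]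
      exact Finset.sum_congr rfl fun m _ => (Finset.sum_mul _ _ _).symm
    simp only [contr, matDeriv_apply, hric, Finset.sum_add_distrib, Finset.sum_sub_distrib, e1,
      ← e2, map_sum, mul_add, mul_sub]
    abel
  have div1 : ∑ i, D i (palatiniVec H C i)
      = (∑ i, ∑ j, ∑ k, H j k * D i (C j i k)) - (∑ j, ∑ k, H j k * D j (∑ i, C i i k))
        - (∑ j, ∑ k, H j k * ∑ i, ∑ m, Γ j i m * C i m k)
        - (∑ j, ∑ k, H j k * ∑ i, ∑ m, C j i m * Γ i m k)
        + (∑ k, ∑ i, ∑ m, Γ i i m * H m k * ∑ a, C a a k)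
        + (∑ i, ∑ k, ∑ m, H i m * Γ i k m * ∑ a, C a a k) := by
    have f1 : ∑ i, ∑ j, ∑ k, C j i k * ∑ m, Γ i j m * H m k
        = ∑ j, ∑ k, H j k * ∑ i, ∑ m, Γ j i m * C i m k := by
      simp only [Finset.mul_sum]
      have a1 : ∀ i j, ∑ k, ∑ m, C j i k * (Γ i j m * H m k)
          = ∑ m, ∑ k, C j i k * (Γ i j m * H m k) := fun _ _ => Finset.sum_comm
      have a2 : ∀ i, ∑ j, ∑ m, ∑ k, C j i k * (Γ i j m * H m k)
          = ∑ m, ∑ k, ∑ j, C j i k * (Γ i j m * H m k) := fun i => by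
        rw [Finset.sum_comm]
        exact Finset.sum_congr rfl fun _ _ => Finset.sum_comm
      simp only [a1, a2]
      rw [Finset.sum_comm]
      refine Finset.sum_congr rfl fun m _ => ?_
      rw [Finset.sum_comm]
      refine Finset.sum_congr rfl fun k _ => ?_
      rw [Finset.sum_comm]
      refine Finset.sum_congr rfl fun j _ => Finset.sum_congr rfl fun i _ => ?_
      rw [hsym i m j]; ring
    have f2 : ∑ i, ∑ j, ∑ k, C j i k * ∑ m, H j m * Γ i k m
        = ∑ j, ∑ k, H j k * ∑ i, ∑ m, C j i m * Γ i m k := by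
      simp only [Finset.mul_sum]
      rw [Finset.sum_comm]
      refine Finset.sum_congr rfl fun j _ => ?_
      have a1 : ∀ i, ∑ k, ∑ m, C j i k * (H j m * Γ i k m)
          = ∑ m, ∑ k, C j i k * (H j m * Γ i k m) := fun _ => Finset.sum_comm
      simp only [a1]
      rw [Finset.sum_comm]
      refine Finset.sum_congr rfl fun k _ => Finset.sum_congr rfl fun i _ =>
        Finset.sum_congr rfl fun m _ => ?_
      ring
    have f3 : ∑ i, ∑ k, (∑ a, C a a k) * ∑ m, Γ i i m * H m k
        = ∑ k, ∑ i, ∑ m, Γ i i m * H m k * ∑ a, C a a k := by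
      rw [Finset.sum_comm]
      refine Finset.sum_congr rfl fun k _ => Finset.sum_congr rfl fun i _ => ?_
      rw [mul_comm, Finset.sum_mul]
    have f4 : ∑ i, ∑ k, (∑ a, C a a k) * ∑ m, H i m * Γ i k m
        = ∑ i, ∑ k, ∑ m, H i m * Γ i k m * ∑ a, C a a k := by
      refine Finset.sum_congr rfl fun k _ => Finset.sum_congr rfl fun i _ => ?_
      rw [mul_comm, Finset.sum_mul]
    rw [← f1, ← f2, ← f3, ← f4]
    simp only [palatiniVec, map_sub, map_sum, Derivation.leibniz, smul_eq_mul, hH', mul_neg,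
      mul_add, Finset.sum_add_distrib, Finset.sum_sub_distrib, Finset.sum_neg_distrib]
    abel
  have div2 : ∑ i, (∑ m, Γ m m i) * palatiniVec H C i
      = (∑ j, ∑ k, H j k * ∑ i, ∑ m, Γ i i m * C j m k)
        - ∑ k, ∑ i, ∑ m, Γ i i m * H m k * ∑ a, C a a k := by
    simp only [palatiniVec, mul_sub, Finset.sum_sub_distrib]
    congr 1
    · have a1 : ∀ i, (∑ m, Γ m m i) * ∑ j, ∑ k, H j k * C j i k
          = ∑ j, ∑ k, H j k * ∑ m, Γ m m i * C j i k := fun i => by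
        rw [Finset.mul_sum]
        refine Finset.sum_congr rfl fun j _ => ?_
        rw [Finset.mul_sum]
        refine Finset.sum_congr rfl fun k _ => ?_
        rw [← Finset.sum_mul]; ring
      simp only [a1]
      rw [Finset.sum_comm]
      refine Finset.sum_congr rfl fun j _ => ?_
      rw [Finset.sum_comm]
      refine Finset.sum_congr rfl fun k _ => ?_
      rw [← Finset.mul_sum, Finset.sum_comm]
    · have a1 : ∀ i, (∑ m, Γ m m i) * ∑ k, H i k * ∑ a, C a a k
          = ∑ k, ∑ m, Γ m m i * H i k * ∑ a, C a a k := fun i => by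
        rw [Finset.mul_sum]
        refine Finset.sum_congr rfl fun k _ => ?_
        rw [← Finset.sum_mul, ← Finset.sum_mul]; ring
      simp only [a1]
      rw [Finset.sum_comm]
      exact Finset.sum_congr rfl fun k _ => Finset.sum_comm
  have last : (∑ i, ∑ k, ∑ m, H i m * Γ i k m * ∑ a, C a a k)
      = ∑ j, ∑ k, H j k * ∑ m, (∑ i, C i i m) * Γ j m k := by
    refine Finset.sum_congr rfl fun j _ => ?_
    rw [Finset.sum_comm]
    refine Finset.sum_congr rfl fun k _ => ?_
    rw [Finset.mul_sum]
    exact Finset.sum_congr rfl fun m _ => by ring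
  rw [lhs, div1, div2, last]
  abel

/-- The variation of the Christoffel symbols, in terms of the covariant derivative of the
variation of the metric. -/
theorem mul_deriv_conn {T : Derivation ℝ A A}
    (hT : ∀ i a, T (D i a) = D i (T a)) (hg : IsUnit g.det) (hs : g.transpose = g)
    {h : Matrix ι ι A} (hh : matDeriv T g = h) (j l k : ι) :
    (g * matDeriv T (conn D g j)) l k = (1 / 2 : ℝ) •
      (covBilin D (conn D g) j h k l + covBilin D (conn D g) k h j l
        - covBilin D (conn D g) l h j k) := by
  have hsym := conn_symm D hs
  have hhs : ∀ a b, h a b = h b a := fun a b => by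
    rw [← hh, matDeriv_apply, matDeriv_apply, ← congrFun (congrFun hs b) a]; rfl
  have hgh : ∀ a b, T (g a b) = h a b := fun a b => by rw [← hh]; rfl
  -- Applying T to the lowered Christoffel formula gives g·T(Γ) + h·Γ on the left; the products of h
  -- and Γ turn partial derivatives of h into covariant ones.
  have h1 := congrArg T (mul_conn_apply D hg j l k)
  have hP : ∀ i a b, (h * conn D g i) a b = (h * conn D g b) a i := fun i a b => by
    simp only [Matrix.mul_apply]
    exact Finset.sum_congr rfl fun m _ => by rw [hsym]
  have hPt : ∀ i a b, ((conn D g i).transpose * h) a b = (h * conn D g i) b a := fun i a b => by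
    simp only [Matrix.mul_apply, Matrix.transpose_apply]
    exact Finset.sum_congr rfl fun m _ => by rw [hhs m b, mul_comm]
  have h2 := congrFun (congrFun (matDeriv_mul T g (conn D g j)) l) k
  rw [matDeriv_apply, h1, hh, Matrix.add_apply] at h2
  rw [← sub_eq_iff_eq_add'.2 h2]
  simp only [Derivation.map_smul, map_add, map_sub, hT, hgh, covBilin, Matrix.sub_apply, hPt,
    matDeriv_apply]
  rw [hP k l j, hP l j k, hP l k j, sub_eq_iff_eq_add]
  have h3 : (h * conn D g j) l k = (1 / 2 : ℝ) • ((h * conn D g j) l k + (h * conn D g j) l k) :=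
    (half_smul_eq rfl).symm
  refine Eq.trans ?_ (congrArg (_ + ·) h3.symm)
  rw [← smul_add]
  congr 1
  abel

/-- Under the Ricci flow the vector field in the Palatini identity is `∇R`. -/
theorem palatiniVec_ricciFlow (hD : ∀ i j a, D i (D j a) = D j (D i a)) {T : Derivation ℝ A A}
    (hT : ∀ i a, T (D i a) = D i (T a)) (hg : IsUnit g.det) (hs : g.transpose = g)
    (hflow : matDeriv T g = (-2 : ℝ) • ric D (conn D g)) (i : ι) :
    palatiniVec g⁻¹ (fun j => matDeriv T (conn D g j)) i
      = ∑ l, g⁻¹ i l * D l (contr g⁻¹ (ric D (conn D g))) := by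
  have hHs : ∀ i j, g⁻¹ i j = g⁻¹ j i := fun i j =>
    congrFun (congrFun (inv_transpose_self hs) j) i
  -- Symmetry of Ric is read off from the flow equation, since Ric is -1/2 times the derivative of
  -- the symmetric matrix g. No first Bianchi identity is needed.
  have hRs : ∀ j k, ric D (conn D g) j k = ric D (conn D g) k j := fun j k => by
    have h : ric D (conn D g) = (-1 / 2 : ℝ) • matDeriv T g := by
      rw [hflow, smul_smul]; norm_num
    rw [h, Matrix.smul_apply, Matrix.smul_apply, matDeriv_apply, matDeriv_apply,
      ← congrFun (congrFun hs k) j]; rfl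
  have hb := contracted_bianchi hD hg hs
  have hd := fun l => deriv_contr_inv D hg hs (ric D (conn D g)) l
  set Γ := conn D g with hΓ
  set H := g⁻¹ with hH
  set N : ι → Matrix ι ι A := fun l => covBilin D Γ l (ric D Γ) with hN
  have hNs : ∀ l j k, N l j k = N l k j := fun l j k => by
    have h0 : (ric D Γ).transpose = ric D Γ := by ext a b; exact hRs b a
    have h1 : (N l).transpose = N l := by
      simp only [hN, covBilin, Matrix.transpose_sub, Matrix.transpose_mul,
        Matrix.transpose_transpose, ← matDeriv_transpose, h0]
      abel
    exact congrFun (congrFun h1 k) j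
  have hC : ∀ j i k, matDeriv T (Γ j) i k
      = ∑ l, H i l * (N l j k - N j k l - N k j l) := by
    intro j i k
    have h1 : matDeriv T (Γ j) = H * (g * matDeriv T (Γ j)) := by
      rw [← Matrix.mul_assoc, hH, Matrix.nonsing_inv_mul _ hg, Matrix.one_mul]
    have hsm : ∀ l, covBilin D Γ l ((-2 : ℝ) • ric D Γ) = (-2 : ℝ) • N l := fun l => by
      have : matDeriv (D l) ((-2 : ℝ) • ric D Γ) = (-2 : ℝ) • matDeriv (D l) (ric D Γ) := by
        ext; simp
      simp only [hN, covBilin, this, Matrix.mul_smul, Matrix.smul_mul, smul_sub]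
    rw [h1, Matrix.mul_apply]
    refine Finset.sum_congr rfl fun l _ => ?_
    congr 1
    rw [hΓ, mul_deriv_conn hT hg hs hflow, ← hΓ, hsm, hsm, hsm]
    simp only [Matrix.smul_apply, ← smul_add, ← smul_sub, smul_smul]
    norm_num
    abel
  -- the three contractions
  have c1 : ∀ l, ∑ j, ∑ k, H j k * N l j k = D l (contr H (ric D Γ)) := fun l => (hd l).symm
  have c2 : ∀ l, 2 * ∑ j, ∑ k, H j k * N j k l = D l (contr H (ric D Γ)) := fun l => by
    rw [hb]
    congr 1
    exact Finset.sum_congr rfl fun j _ => Finset.sum_congr rfl fun k _ => by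
      rw [hHs j k, hNs j k l]
  have c3 : ∀ l, ∑ j, ∑ k, H j k * N k j l = ∑ j, ∑ k, H j k * N j k l := fun l => by
    rw [Finset.sum_comm]
    exact Finset.sum_congr rfl fun j _ => Finset.sum_congr rfl fun k _ => by rw [hHs]
  -- In the trace of C the two divergence-like terms cancel by symmetry, leaving -∇R.
  have tr : ∀ k, ∑ m, matDeriv T (Γ m) m k = -D k (contr H (ric D Γ)) := by
    intro k
    simp only [hC, mul_sub, Finset.sum_sub_distrib]
    have : ∑ m, ∑ l, H m l * N l m k = ∑ m, ∑ l, H m l * N m k l := by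
      rw [Finset.sum_comm]
      exact Finset.sum_congr rfl fun j _ => Finset.sum_congr rfl fun l _ => by
        rw [hHs, hNs]
    rw [this, c1]
    abel
  -- The contraction over the lower indices is ∇R minus twice the divergence of Ric, hence zero by
  -- contracted Bianchi.
  have first : ∑ j, ∑ k, H j k * matDeriv T (Γ j) i k = 0 := by
    have : ∑ j, ∑ k, H j k * matDeriv T (Γ j) i k
        = ∑ l, H i l * ((∑ j, ∑ k, H j k * N l j k) - (∑ j, ∑ k, H j k * N j k l)
          - ∑ j, ∑ k, H j k * N k j l) := by
      have e : ∀ j k, H j k * matDeriv T (Γ j) i k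
          = ∑ l, H i l * (H j k * N l j k - H j k * N j k l - H j k * N k j l) := fun j k => by
        rw [hC, Finset.mul_sum]
        exact Finset.sum_congr rfl fun l _ => by ring
      simp only [e]
      have e' : ∀ j, ∑ k, ∑ l, H i l * (H j k * N l j k - H j k * N j k l - H j k * N k j l)
          = ∑ l, ∑ k, H i l * (H j k * N l j k - H j k * N j k l - H j k * N k j l) :=
        fun j => Finset.sum_comm
      simp only [e']
      rw [Finset.sum_comm]
      refine Finset.sum_congr rfl fun l _ => ?_
      simp only [← Finset.mul_sum, Finset.sum_sub_distrib]
    rw [this]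
    refine Finset.sum_eq_zero fun l _ => ?_
    rw [c1, c3, ← c2 l]
    ring
  simp only [palatiniVec]
  rw [first]
  simp only [tr, mul_neg, Finset.sum_neg_distrib]
  abel

/-- The evolution equation of the scalar curvature under the Ricci flow; the first two sums are
the Laplacian of the scalar curvature. -/
theorem scalar_evolution (hD : ∀ i j a, D i (D j a) = D j (D i a)) {T : Derivation ℝ A A}
    (hT : ∀ i a, T (D i a) = D i (T a)) (hg : IsUnit g.det) (hs : g.transpose = g)
    (hflow : matDeriv T g = (-2 : ℝ) • ric D (conn D g)) :
    T (contr g⁻¹ (ric D (conn D g)))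
      = ∑ i, D i (∑ l, g⁻¹ i l * D l (contr g⁻¹ (ric D (conn D g))))
        + ∑ i, (∑ m, conn D g m m i) * ∑ l, g⁻¹ i l * D l (contr g⁻¹ (ric D (conn D g)))
        + 2 * contr (g⁻¹ * ric D (conn D g) * g⁻¹) (ric D (conn D g)) := by
  have hp := palatini hT hg hs
  simp only [palatiniVec_ricciFlow hD hT hg hs hflow] at hp
  rw [← hp]
  -- The derivative of g⁻¹ falling on Ric is the source of the reaction term 2|Ric|².
  have hinv : matDeriv T g⁻¹ = (2 : ℝ) • (g⁻¹ * ric D (conn D g) * g⁻¹) := by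
    rw [matDeriv_inv T hg, hflow, Matrix.mul_smul, Matrix.smul_mul, ← neg_smul, neg_neg]
  have hinv' : ∀ j k, T (g⁻¹ j k) = 2 * (g⁻¹ * ric D (conn D g) * g⁻¹) j k := fun j k => by
    rw [← matDeriv_apply, hinv, Matrix.smul_apply, two_smul, two_mul]
  simp only [contr, map_sum, Derivation.leibniz, smul_eq_mul, hinv', matDeriv_apply,
    Finset.sum_add_distrib, Finset.mul_sum]
  congr 1
  exact Finset.sum_congr rfl fun _ _ => Finset.sum_congr rfl fun _ _ => by ring

end Evolution

/-! ### Behaviour under a change of coordinates -/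

section ChangeOfCoordinates

variable {ι A B : Type*} [Fintype ι] [DecidableEq ι] [CommRing A] [Algebra ℝ A]
  [CommRing B] [Algebra ℝ B]

/-- Invariance of the scalar curvature: `σ` is the pullback of functions by a map with Jacobian
matrix `J`. -/
theorem scalar_pullback {D : ι → Derivation ℝ A A} {E : ι → Derivation ℝ B B} (σ : A →+* B)
    (hE : ∀ i j b, E i (E j b) = E j (E i b))
    {J : Matrix ι ι B} (hJ : IsUnit J.det) (hJs : ∀ i j a, E i (J a j) = E j (J a i))
    (chain : ∀ i a, E i (σ a) = ∑ c, J c i * σ (D c a))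
    {g : Matrix ι ι A} (hg : IsUnit g.det) (hs : g.transpose = g) {g' : Matrix ι ι B}
    (hg' : g' = J.transpose * g.map σ * J) :
    contr g'⁻¹ (ric E (conn E g')) = σ (contr g⁻¹ (ric D (conn D g))) := by
  have hgu : IsUnit (g.map σ).det := by
    have := hg.map σ
    rwa [RingHom.map_det] at this
  have hgu' : IsUnit g'.det := by
    rw [hg', Matrix.det_mul, Matrix.det_mul, Matrix.det_transpose]
    exact (hJ.mul hgu).mul hJ
  have hsσ : (g.map σ).transpose = g.map σ := by rw [← Matrix.transpose_map, hs]
  have hs' : g'.transpose = g' := by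
    rw [hg', Matrix.transpose_mul, Matrix.transpose_mul, Matrix.transpose_transpose, hsσ,
      Matrix.mul_assoc]
  have hJJ : J * J⁻¹ = 1 := Matrix.mul_nonsing_inv _ hJ
  have hJJ' : J⁻¹ * J = 1 := Matrix.nonsing_inv_mul _ hJ
  have chainM : ∀ i (M : Matrix ι ι A),
      matDeriv (E i) (M.map σ) = ∑ c, J c i • (matDeriv (D c) M).map σ := fun i M => by
    ext a b
    simp [Matrix.sum_apply, chain]
  -- the pulled back connection, and its gauge transform by `J`
  set P : ι → Matrix ι ι B := fun i => ∑ c, J c i • (conn D g c).map σ with hP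
  set Γ' : ι → Matrix ι ι B := fun i => J⁻¹ * (matDeriv (E i) J + P i * J) with hΓ'
  have hJΓ : ∀ i, matDeriv (E i) J = J * Γ' i - P i * J := fun i => by
    simp only [hΓ']
    rw [← Matrix.mul_assoc, hJJ, Matrix.one_mul]; abel
  -- The candidate is recognised by uniqueness of the Levi-Civita connection: it is torsion free
  -- because J has symmetric derivatives, and metric by the chain rule.
  have hconn : ∀ i, Γ' i = conn E g' i := by
    refine conn_unique hgu' hs' ?_ ?_
    · intro i j k
      simp only [hΓ', Matrix.mul_apply]
      refine Finset.sum_congr rfl fun a _ => ?_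
      congr 1
      rw [Matrix.add_apply, Matrix.add_apply, matDeriv_apply, matDeriv_apply, hJs]
      congr 1
      simp only [hP, Matrix.mul_apply, Matrix.sum_apply, Matrix.smul_apply, Matrix.map_apply,
        smul_eq_mul, Finset.sum_mul]
      rw [Finset.sum_comm]
      refine Finset.sum_congr rfl fun b _ => Finset.sum_congr rfl fun c _ => ?_
      rw [conn_symm D hs]; ring
    · intro i
      have h1 : g' * Γ' i = J.transpose * g.map σ * (matDeriv (E i) J + P i * J) := by
        simp only [hΓ', hg']
        rw [Matrix.mul_assoc, ← Matrix.mul_assoc J, hJJ, Matrix.one_mul]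
      have h2 : matDeriv (E i) (g.map σ) = g.map σ * P i + (P i).transpose * g.map σ := by
        rw [chainM]
        simp only [deriv_metric D hg hs, hP]
        rw [Matrix.transpose_sum, Finset.mul_sum, Finset.sum_mul, ← Finset.sum_add_distrib]
        refine Finset.sum_congr rfl fun c _ => ?_
        rw [Matrix.map_add _ (map_add σ), Matrix.map_mul, Matrix.map_mul, smul_add,
          Matrix.mul_smul, Matrix.transpose_smul, Matrix.smul_mul]
        rfl
      rw [h1, hg', matDeriv_mul, matDeriv_mul, h2, matDeriv_transpose]
      simp only [Matrix.transpose_mul, Matrix.transpose_add, Matrix.transpose_transpose, hsσ]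
      noncomm_ring
  -- Curvature is conjugated by the gauge transformation J, and the curvature of the pulled back
  -- connection is the pullback of the curvature (`hF`); the second derivatives of the coordinate
  -- map drop out by symmetry.
  have hcurv : ∀ i j, J * curv E Γ' i j
      = (∑ a, ∑ b, (J a i * J b j) • (curv D (conn D g) a b).map σ) * J := by
    intro i j
    have hF : curv E P i j = ∑ a, ∑ b, (J a i * J b j) • (curv D (conn D g) a b).map σ := by
      have hdP : ∀ i j, matDeriv (E i) (P j) = ∑ c, E i (J c j) • (conn D g c).map σ
          + ∑ a, ∑ b, (J a i * J b j) • (matDeriv (D a) (conn D g b)).map σ := fun i j => by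
        rw [Finset.sum_comm, ← Finset.sum_add_distrib]
        have h0 : matDeriv (E i) (P j) = ∑ c, matDeriv (E i) (J c j • (conn D g c).map σ) := by
          ext a b; simp [hP, Matrix.sum_apply]
        rw [h0]
        refine Finset.sum_congr rfl fun c _ => ?_
        have h1 : matDeriv (E i) (J c j • (conn D g c).map σ)
            = E i (J c j) • (conn D g c).map σ + J c j • matDeriv (E i) ((conn D g c).map σ) := by
          ext a b; simp; ring
        rw [h1, chainM, Finset.smul_sum]
        congr 1
        refine Finset.sum_congr rfl fun a _ => ?_
        rw [smul_smul, mul_comm]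
      have hPP : ∀ i j, P i * P j
          = ∑ a, ∑ b, (J a i * J b j) • ((conn D g a).map σ * (conn D g b).map σ) := fun i j => by
        simp only [hP]
        rw [Finset.sum_mul_sum]
        simp only [Matrix.smul_mul, Matrix.mul_smul, smul_smul]
        refine Finset.sum_congr rfl fun a _ => Finset.sum_congr rfl fun b _ => ?_
        rw [mul_comm]
      have hsw : ∀ (F : ι → ι → Matrix ι ι B), ∑ a, ∑ b, (J a j * J b i) • F a b
          = ∑ a, ∑ b, (J a i * J b j) • F b a := fun F => by
        rw [Finset.sum_comm]
        exact Finset.sum_congr rfl fun a _ => Finset.sum_congr rfl fun b _ => by rw [mul_comm]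
      rw [curv, hdP i j, hdP j i, hPP, hPP, hsw, hsw]
      simp only [hJs j i]
      rw [add_sub_add_left_eq_sub, ← Finset.sum_sub_distrib, ← Finset.sum_sub_distrib,
        ← Finset.sum_add_distrib]
      refine Finset.sum_congr rfl fun a _ => ?_
      rw [← Finset.sum_sub_distrib, ← Finset.sum_sub_distrib, ← Finset.sum_add_distrib]
      refine Finset.sum_congr rfl fun b _ => ?_
      rw [← smul_sub, ← smul_sub, ← smul_add]
      congr 1
      rw [curv, Matrix.map_add _ (map_add σ), Matrix.map_sub _ (map_sub σ),
        Matrix.map_sub _ (map_sub σ), Matrix.map_mul, Matrix.map_mul]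
    rw [← hF]
    have h := matDeriv_comm hE i j J
    rw [hJΓ i, hJΓ j] at h
    simp only [matDeriv_sub, matDeriv_mul, hJΓ] at h
    rw [← sub_eq_zero] at h ⊢
    rw [← h]
    simp only [curv]
    noncomm_ring
  have hcurv' : ∀ i j, curv E Γ' i j
      = ∑ a, ∑ b, (J a i * J b j) • (J⁻¹ * ((curv D (conn D g) a b).map σ * J)) := fun i j => by
    have h := congrArg (J⁻¹ * ·) (hcurv i j)
    simp only [← Matrix.mul_assoc, hJJ', Matrix.one_mul] at h
    rw [h, Matrix.mul_assoc, Finset.sum_mul, Finset.mul_sum]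
    refine Finset.sum_congr rfl fun a _ => ?_
    rw [Finset.sum_mul, Finset.mul_sum]
    refine Finset.sum_congr rfl fun b _ => ?_
    rw [Matrix.smul_mul, Matrix.mul_smul]
  have hric : ric E Γ' = J.transpose * (ric D (conn D g)).map σ * J := by
    ext j k
    have e1 : ∀ a b, ∑ i, J a i * (J⁻¹ * ((curv D (conn D g) a b).map σ * J)) i k
        = ((curv D (conn D g) a b).map σ * J) a k := fun a b => by
      have h : J * (J⁻¹ * ((curv D (conn D g) a b).map σ * J))
          = (curv D (conn D g) a b).map σ * J := by
        rw [← Matrix.mul_assoc, hJJ, Matrix.one_mul]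
      rw [← Matrix.mul_apply, h]
    have e2 : ric E Γ' j k
        = ∑ b, J b j * ∑ a, ((curv D (conn D g) a b).map σ * J) a k := by
      simp only [ric, Matrix.of_apply, hcurv', Matrix.sum_apply, Matrix.smul_apply, smul_eq_mul]
      simp only [← e1, Finset.mul_sum]
      rw [Finset.sum_comm]
      have : ∀ a, ∑ i, ∑ b, J a i * J b j * (J⁻¹ * ((curv D (conn D g) a b).map σ * J)) i k
          = ∑ b, ∑ i, J a i * J b j * (J⁻¹ * ((curv D (conn D g) a b).map σ * J)) i k :=
        fun a => Finset.sum_comm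
      simp only [this]
      rw [Finset.sum_comm]
      refine Finset.sum_congr rfl fun b _ => Finset.sum_congr rfl fun a _ =>
        Finset.sum_congr rfl fun i _ => by ring
    rw [e2, Matrix.mul_assoc, Matrix.mul_apply]
    refine Finset.sum_congr rfl fun b _ => ?_
    rw [Matrix.transpose_apply]
    congr 1
    simp only [Matrix.mul_apply, Matrix.map_apply, ric, Matrix.of_apply, map_sum, Finset.sum_mul]
    exact Finset.sum_comm
  have hcontr : ∀ H S : Matrix ι ι B, contr H S = (H.transpose * S).trace := fun H S => by
    simp only [contr, Matrix.trace, Matrix.diag, Matrix.mul_apply, Matrix.transpose_apply]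
    exact Finset.sum_comm
  have hinvσ : (g.map σ)⁻¹ = g⁻¹.map σ := by
    refine Matrix.inv_eq_left_inv ?_
    rw [← Matrix.map_mul, Matrix.nonsing_inv_mul _ hg]
    exact Matrix.map_one _ (map_zero σ) (map_one σ)
  have hinv' : g'⁻¹ = J⁻¹ * g⁻¹.map σ * (J⁻¹).transpose := by
    rw [hg', Matrix.mul_inv_rev, Matrix.mul_inv_rev, hinvσ, Matrix.transpose_nonsing_inv,
      Matrix.mul_assoc]
  have hσ : σ (contr g⁻¹ (ric D (conn D g))) = contr (g⁻¹.map σ) ((ric D (conn D g)).map σ) := by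
    simp [contr]
  have hΓeq : conn E g' = Γ' := funext fun i => (hconn i).symm
  rw [hσ, hΓeq, hric, hcontr, hcontr, inv_transpose_self hs', hinv']
  have hJt : (J⁻¹).transpose * J.transpose = 1 := by
    rw [← Matrix.transpose_mul, hJJ, Matrix.transpose_one]
  have hst : (g⁻¹.map σ).transpose = g⁻¹.map σ := by
    rw [← Matrix.transpose_map, inv_transpose_self hs]
  rw [hst]
  have : J⁻¹ * g⁻¹.map σ * (J⁻¹).transpose * (J.transpose * (ric D (conn D g)).map σ * J)
      = J⁻¹ * (g⁻¹.map σ * (((J⁻¹).transpose * J.transpose) * (ric D (conn D g)).map σ) * J) := by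
    noncomm_ring
  rw [this, hJt, Matrix.one_mul, Matrix.trace_mul_comm, Matrix.mul_assoc, hJJ, Matrix.mul_one]

end ChangeOfCoordinates

/-! ### The differential ring of smooth functions on a set -/

section SmoothFunctions

variable {V : Type*} [NormedAddCommGroup V] [NormedSpace ℝ V]

/-- The algebra of functions on `S` that are restrictions of functions smooth within `S`. -/
def smoothFn (S : Set V) : Subalgebra ℝ (S → ℝ) where
  carrier := {f | ∃ F : V → ℝ, ContDiffOn ℝ ∞ F S ∧ ∀ x : S, F x = f x}
  mul_mem' := by
    rintro a b ⟨F, hF, hFa⟩ ⟨G, hG, hGb⟩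
    exact ⟨F * G, hF.mul hG, fun x => by simp [hFa, hGb]⟩
  add_mem' := by
    rintro a b ⟨F, hF, hFa⟩ ⟨G, hG, hGb⟩
    exact ⟨F + G, hF.add hG, fun x => by simp [hFa, hGb]⟩
  algebraMap_mem' r := ⟨fun _ => r, contDiffOn_const, fun _ => rfl⟩

variable {S : Set V}

/-- The restriction of a smooth function. -/
def smoothFn.mk (F : V → ℝ) (hF : ContDiffOn ℝ ∞ F S) : smoothFn S :=
  ⟨fun x => F x, F, hF, fun _ => rfl⟩

/-- A representative of an element of `smoothFn S`. -/
def smoothRep (f : smoothFn S) : V → ℝ := f.2.choose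

theorem contDiffOn_smoothRep (f : smoothFn S) : ContDiffOn ℝ ∞ (smoothRep f) S := f.2.choose_spec.1

theorem smoothRep_apply (f : smoothFn S) (x : S) : (smoothRep f) x = f.1 x := f.2.choose_spec.2 x

theorem smoothFn.ext' {f h : smoothFn S} (H : ∀ x, f.1 x = h.1 x) : f = h :=
  Subtype.ext (funext H)

theorem differentiable_smoothRep (f : smoothFn S) {x : V} (hx : x ∈ S) :
    DifferentiableWithinAt ℝ (smoothRep f) S x :=
  ((contDiffOn_smoothRep f) x hx).differentiableWithinAt (by simp)

/-- Evaluation at a point. -/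
def smoothFn.eval (x : S) : smoothFn S →+* ℝ :=
  (Pi.evalRingHom (fun _ : S => ℝ) x).comp (smoothFn S).val.toRingHom

@[simp] theorem smoothFn.eval_apply (x : S) (f : smoothFn S) : smoothFn.eval x f = f.1 x := rfl

theorem smoothFn.isUnit {f : smoothFn S} (hf : ∀ x, f.1 x ≠ 0) : IsUnit f := by
  refine IsUnit.of_mul_eq_one (smoothFn.mk (fun x => ((smoothRep f) x)⁻¹)
    ((contDiffOn_smoothRep f).inv fun x hx => ?_)) (smoothFn.ext' fun x => ?_)
  · rw [smoothRep_apply f ⟨x, hx⟩]; exact hf _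
  · change f.1 x * ((smoothRep f) x)⁻¹ = 1
    rw [smoothRep_apply f, mul_inv_cancel₀ (hf x)]

theorem contDiffOn_dirDeriv (hS : UniqueDiffOn ℝ S) (v : V) {F : V → ℝ}
    (hF : ContDiffOn ℝ ∞ F S) : ContDiffOn ℝ ∞ (fun x => fderivWithin ℝ F S x v) S :=
  (hF.fderivWithin hS (m := ∞) (by simp)).clm_apply contDiffOn_const

/-- The derivative within S depends only on the values on S, so the arbitrary choice in `smoothRep`
is harmless and any convenient extension may be used. -/
theorem fderivWithin_smoothRep_eq {f : smoothFn S} {F : V → ℝ} (h : ∀ x : S, F x = f.1 x) {x : V}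
    (hx : x ∈ S) : fderivWithin ℝ (smoothRep f) S x = fderivWithin ℝ F S x :=
  fderivWithin_congr (fun y hy => by rw [smoothRep_apply f ⟨y, hy⟩, h ⟨y, hy⟩])
    (by rw [smoothRep_apply f ⟨x, hx⟩, h ⟨x, hx⟩])

/-- The directional derivative as a derivation of `smoothFn S`. -/
def dirDeriv (hS : UniqueDiffOn ℝ S) (v : V) : Derivation ℝ (smoothFn S) (smoothFn S) :=
  Derivation.mk'
    { toFun := fun f => smoothFn.mk _ (contDiffOn_dirDeriv hS v (contDiffOn_smoothRep f))
      map_add' := fun f h => smoothFn.ext' fun x => by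
        change fderivWithin ℝ (smoothRep (f + h)) S x v
          = fderivWithin ℝ (smoothRep f) S x v + fderivWithin ℝ (smoothRep h) S x v
        rw [fderivWithin_smoothRep_eq (F := (smoothRep f) + (smoothRep h)) (fun y => by
          simp [smoothRep_apply]) x.2,
          fderivWithin_add (hS x x.2) (differentiable_smoothRep f x.2) (differentiable_smoothRep h x.2)]
        rfl
      map_smul' := fun r f => smoothFn.ext' fun x => by
        change fderivWithin ℝ (smoothRep (r • f)) S x v = r • fderivWithin ℝ (smoothRep f) S x v
        rw [fderivWithin_smoothRep_eq (F := r • (smoothRep f)) (fun y => by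
          simp [smoothRep_apply]) x.2,
          fderivWithin_const_smul (hS x x.2) (differentiable_smoothRep f x.2)]
        rfl }
    (fun f h => smoothFn.ext' fun x => by
      change fderivWithin ℝ (smoothRep (f * h)) S x v
        = f.1 x * fderivWithin ℝ (smoothRep h) S x v + h.1 x * fderivWithin ℝ (smoothRep f) S x v
      rw [fderivWithin_smoothRep_eq (F := (smoothRep f) * (smoothRep h)) (fun y => by
          simp [smoothRep_apply]) x.2,
          fderivWithin_mul (hS x x.2) (differentiable_smoothRep f x.2) (differentiable_smoothRep h x.2),
          ← smoothRep_apply f, ← smoothRep_apply h]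
      rfl)

theorem dirDeriv_apply (hS : UniqueDiffOn ℝ S) (v : V) {f : smoothFn S} {F : V → ℝ}
    (h : ∀ x : S, F x = f.1 x) (x : S) :
    (dirDeriv hS v f).1 x = fderivWithin ℝ F S x v := by
  rw [← fderivWithin_smoothRep_eq h x.2]; rfl

/-- Symmetry of second derivatives within S. At boundary points, such as t = 0, it is a limit of
interior symmetry, hence the hypothesis that S lies in the closure of its interior. -/
theorem dirDeriv_comm (hS : UniqueDiffOn ℝ S) (hS' : S ⊆ closure (interior S)) (v w : V)
    (f : smoothFn S) : dirDeriv hS v (dirDeriv hS w f) = dirDeriv hS w (dirDeriv hS v f) := by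
  refine smoothFn.ext' fun x => ?_
  have key : ∀ v w : V, (dirDeriv hS v (dirDeriv hS w f)).1 x
      = fderivWithin ℝ (fderivWithin ℝ (smoothRep f) S) S x v w := fun v w => by
    rw [dirDeriv_apply hS v (F := fun y => fderivWithin ℝ (smoothRep f) S y w) (fun _ => rfl)]
    have hd : DifferentiableWithinAt ℝ (fderivWithin ℝ (smoothRep f) S) S x :=
      (((contDiffOn_smoothRep f).fderivWithin hS (m := ∞) (by simp)) x x.2).differentiableWithinAt
        (by simp)
    rw [fderivWithin_clm_apply (hS x x.2) hd (differentiableWithinAt_const _)]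
    simp
  rw [key, key]
  exact ((contDiffOn_smoothRep f) x x.2).isSymmSndFDerivWithinAt (by
    rw [minSmoothness_of_isRCLikeNormedField]
    exact WithTop.coe_le_coe.2 (le_top : (2 : ℕ∞) ≤ ⊤)) hS
    (hS' x.2) x.2 v w

end SmoothFunctions

/-! ### Time-dependent metrics on a region of `ℝⁿ` -/

section TimeDependent

variable {n : ℕ} {J : Set ℝ} {U : Set (Model n)}

/-- The spatial partial derivatives on `J ×ˢ U`. -/
def spaceDeriv (hS : UniqueDiffOn ℝ (J ×ˢ U)) (i : Fin n) :
    Derivation ℝ (smoothFn (J ×ˢ U)) (smoothFn (J ×ˢ U)) :=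
  dirDeriv hS ((0 : ℝ), (EuclideanSpace.single i 1 : Model n))

/-- The time derivative on `J ×ˢ U`. -/
def timeDeriv (hS : UniqueDiffOn ℝ (J ×ˢ U)) :
    Derivation ℝ (smoothFn (J ×ˢ U)) (smoothFn (J ×ˢ U)) :=
  dirDeriv hS ((1 : ℝ), (0 : Model n))

/-- As U is open, the derivative within J × U in a spatial direction is the ordinary partial
derivative of a time slice, even when t is an end point of J. This links the abstract ring to the
coordinate definitions. -/
theorem spaceDeriv_apply (hS : UniqueDiffOn ℝ (J ×ˢ U)) (hU : IsOpen U) (i : Fin n)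
    (f : smoothFn (J ×ˢ U)) {t : ℝ} {y : Model n} (ht : t ∈ J) (hy : y ∈ U)
    {φ : Model n → ℝ} (hφ : ∀ z (hz : z ∈ U), φ z = f.1 ⟨(t, z), ht, hz⟩) :
    (spaceDeriv hS i f).1 ⟨(t, y), ht, hy⟩ = partialDeriv i φ y := by
  have h1 := (differentiable_smoothRep f (x := (t, y)) ⟨ht, hy⟩).hasFDerivWithinAt
  have h2 : HasFDerivWithinAt (fun z : Model n => (t, z))
      (ContinuousLinearMap.inr ℝ ℝ (Model n)) U y := (hasFDerivAt_prodMk_right t y).hasFDerivWithinAt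
  have h3 := h1.comp y h2 (fun z hz => ⟨ht, hz⟩)
  have h4 := (h3.hasFDerivAt (hU.mem_nhds hy)).congr_of_eventuallyEq (f₁ := φ) (by
    filter_upwards [hU.mem_nhds hy] with z hz
    rw [hφ z hz, ← smoothRep_apply f]; rfl)
  rw [partialDeriv, h4.fderiv]
  rfl

theorem timeDeriv_hasDerivWithinAt (hS : UniqueDiffOn ℝ (J ×ˢ U)) (f : smoothFn (J ×ˢ U)) {t : ℝ}
    {y : Model n} (ht : t ∈ J) (hy : y ∈ U) {φ : ℝ → ℝ}
    (hφ : ∀ s (hs : s ∈ J), φ s = f.1 ⟨(s, y), hs, hy⟩) :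
    HasDerivWithinAt φ ((timeDeriv hS f).1 ⟨(t, y), ht, hy⟩) J t := by
  have h1 := (differentiable_smoothRep f (x := (t, y)) ⟨ht, hy⟩).hasFDerivWithinAt
  have h2 : HasDerivWithinAt (fun s : ℝ => (s, y)) ((1 : ℝ), (0 : Model n)) J t :=
    ((hasDerivAt_id t).prodMk (hasDerivAt_const t y)).hasDerivWithinAt
  have h3 := h1.comp_hasDerivWithinAt t h2
    (show Set.MapsTo (fun s : ℝ => (s, y)) J (J ×ˢ U) from fun s hs => ⟨hs, hy⟩)
  refine h3.congr (fun s hs => ?_) ?_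
  · rw [hφ s hs, ← smoothRep_apply f]; rfl
  · rw [hφ t ht, ← smoothRep_apply f]; rfl

/-- The point `(t, y)` of `J ×ˢ U`. -/
abbrev stPoint {t : ℝ} {y : Model n} (ht : t ∈ J) (hy : y ∈ U) : (J ×ˢ U : Set (ℝ × Model n)) :=
  ⟨(t, y), ht, hy⟩

/-- The matrix of smooth functions attached to a smooth time-dependent metric. -/
def metricMat (G : ℝ → Model n → Matrix (Fin n) (Fin n) ℝ)
    (hG : ∀ i j, ContDiffOn ℝ ∞ (fun q : ℝ × Model n => G q.1 q.2 i j) (J ×ˢ U)) :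
    Matrix (Fin n) (Fin n) (smoothFn (J ×ˢ U)) :=
  Matrix.of fun i j => smoothFn.mk _ (hG i j)

variable {G : ℝ → Model n → Matrix (Fin n) (Fin n) ℝ}
  {hG : ∀ i j, ContDiffOn ℝ ∞ (fun q : ℝ × Model n => G q.1 q.2 i j) (J ×ˢ U)}

theorem metricMat_eval (q : (J ×ˢ U : Set (ℝ × Model n))) :
    (metricMat G hG).map (smoothFn.eval q) = G q.1.1 q.1.2 := rfl

theorem metricMat_isUnit (hdet : ∀ t ∈ J, ∀ y ∈ U, (G t y).det ≠ 0) :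
    IsUnit (metricMat G hG).det := by
  refine smoothFn.isUnit fun q => ?_
  rw [← smoothFn.eval_apply, RingHom.map_det]
  exact hdet _ q.2.1 _ q.2.2

theorem map_inv_of_isUnit {ι A B : Type*} [Fintype ι] [DecidableEq ι] [CommRing A] [CommRing B]
    (σ : A →+* B) {g : Matrix ι ι A} (hg : IsUnit g.det) : g⁻¹.map σ = (g.map σ)⁻¹ := by
  refine (Matrix.inv_eq_left_inv ?_).symm
  rw [← Matrix.map_mul, Matrix.nonsing_inv_mul _ hg]
  exact Matrix.map_one _ (map_zero σ) (map_one σ)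

theorem metricMat_inv_apply (hg : IsUnit (metricMat G hG).det) (i j : Fin n)
    (q : (J ×ˢ U : Set (ℝ × Model n))) :
    ((metricMat G hG)⁻¹ i j).1 q = (G q.1.1 q.1.2)⁻¹ i j := by
  rw [← metricMat_eval (hG := hG), ← map_inv_of_isUnit _ hg]; rfl

theorem christoffel_eq (hS : UniqueDiffOn ℝ (J ×ˢ U)) (hU : IsOpen U)
    (hg : IsUnit (metricMat G hG).det) (i k j : Fin n) {t : ℝ} {y : Model n} (ht : t ∈ J)
    (hy : y ∈ U) :
    christoffel (G t) k i j y = (conn (spaceDeriv hS) (metricMat G hG) i k j).1 ⟨(t, y), ht, hy⟩ := by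
  rw [← smoothFn.eval_apply]
  have hd : ∀ i a b, partialDeriv i (fun z => G t z a b) y
      = smoothFn.eval (stPoint ht hy) (spaceDeriv hS i (metricMat G hG a b)) := fun i a b =>
    (spaceDeriv_apply hS hU i (metricMat G hG a b) ht hy fun z hz => rfl).symm
  have hsm : ∀ (r : ℝ) (f : smoothFn (J ×ˢ U)), smoothFn.eval (stPoint ht hy) (r • f)
      = r * smoothFn.eval (stPoint ht hy) f := fun _ _ => rfl
  simp only [christoffel, conn, Matrix.of_apply, hsm, map_sum, map_mul, map_add, map_sub, hd]
  congr 1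
  refine Finset.sum_congr rfl fun l _ => ?_
  congr 1
  exact (metricMat_inv_apply hg k l ⟨(t, y), ht, hy⟩).symm

theorem riemann_eq (hS : UniqueDiffOn ℝ (J ×ˢ U)) (hU : IsOpen U)
    (hg : IsUnit (metricMat G hG).det) (i j k l : Fin n) {t : ℝ} {y : Model n} (ht : t ∈ J)
    (hy : y ∈ U) :
    riemann (G t) i j k l y
      = (curv (spaceDeriv hS) (conn (spaceDeriv hS) (metricMat G hG)) i j l k).1
          ⟨(t, y), ht, hy⟩ := by
  rw [← smoothFn.eval_apply]
  have hd : ∀ i l j k, partialDeriv i (christoffel (G t) l j k) y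
      = smoothFn.eval (stPoint ht hy)
        (spaceDeriv hS i (conn (spaceDeriv hS) (metricMat G hG) j l k)) := fun i l j k =>
    (spaceDeriv_apply hS hU i _ ht hy fun z hz => christoffel_eq hS hU hg j l k ht hz).symm
  have hc : ∀ i k j, christoffel (G t) k i j y
      = smoothFn.eval (stPoint ht hy) (conn (spaceDeriv hS) (metricMat G hG) i k j) :=
    fun i k j => christoffel_eq hS hU hg i k j ht hy
  simp only [riemann, curv, Matrix.add_apply, Matrix.sub_apply, matDeriv_apply, Matrix.mul_apply,
    map_add, map_sub, map_sum, map_mul, hd, hc, Finset.sum_sub_distrib]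
  congr 2 <;> exact Finset.sum_congr rfl fun m _ => mul_comm _ _

theorem ricci_eq (hS : UniqueDiffOn ℝ (J ×ˢ U)) (hU : IsOpen U)
    (hg : IsUnit (metricMat G hG).det) (j k : Fin n) {t : ℝ} {y : Model n} (ht : t ∈ J)
    (hy : y ∈ U) :
    ricci (G t) j k y = (ric (spaceDeriv hS) (conn (spaceDeriv hS) (metricMat G hG)) j k).1
      ⟨(t, y), ht, hy⟩ := by
  rw [← smoothFn.eval_apply]
  simp only [ricci, ric, Matrix.of_apply, map_sum]
  exact Finset.sum_congr rfl fun i _ => riemann_eq hS hU hg i j k i ht hy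

theorem scal_eq (hS : UniqueDiffOn ℝ (J ×ˢ U)) (hU : IsOpen U)
    (hg : IsUnit (metricMat G hG).det) {t : ℝ} {y : Model n} (ht : t ∈ J) (hy : y ∈ U) :
    scal (G t) y = (contr (metricMat G hG)⁻¹
      (ric (spaceDeriv hS) (conn (spaceDeriv hS) (metricMat G hG)))).1 ⟨(t, y), ht, hy⟩ := by
  rw [← smoothFn.eval_apply]
  simp only [scal, contr, map_sum, map_mul]
  refine Finset.sum_congr rfl fun j _ => Finset.sum_congr rfl fun k _ => ?_
  rw [ricci_eq hS hU hg j k ht hy]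
  congr 1
  exact (metricMat_inv_apply hg j k ⟨(t, y), ht, hy⟩).symm

end TimeDependent

/-! ### Inequalities at a point -/

section Pointwise

variable {n : ℕ}

-- The factor B plays the role of an orthonormal frame: it turns contractions with g⁻¹ into
-- Euclidean sums of squares.
open scoped MatrixOrder Matrix.Norms.L2Operator in
theorem exists_transpose_mul_self {H : Matrix (Fin n) (Fin n) ℝ} (hH : H.PosSemidef) :
    ∃ B : Matrix (Fin n) (Fin n) ℝ, H = B.transpose * B := by
  obtain ⟨B, hB⟩ := CStarAlgebra.nonneg_iff_eq_star_mul_self.mp hH.nonneg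
  exact ⟨B, hB⟩

theorem contr_eq_trace {ι A : Type*} [Fintype ι] [CommRing A] (H S : Matrix ι ι A) :
    contr H S = (H.transpose * S).trace := by
  simp only [contr, Matrix.trace, Matrix.diag, Matrix.mul_apply, Matrix.transpose_apply]
  exact Finset.sum_comm

/-- `R² ≤ n |Ric|²`. -/
theorem contr_sq_le {H : Matrix (Fin n) (Fin n) ℝ} (hH : H.PosSemidef)
    (S : Matrix (Fin n) (Fin n) ℝ) : contr H S ^ 2 ≤ n * contr (H * S * H) S := by
  obtain ⟨B, rfl⟩ := exists_transpose_mul_self hH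
  -- W is S in an orthonormal frame. Cauchy–Schwarz is applied to its diagonal, and the off-diagonal
  -- squares are discarded.
  set W := B * S * B.transpose with hW
  have h1 : contr (B.transpose * B) S = W.trace := by
    rw [contr_eq_trace, Matrix.transpose_mul, Matrix.transpose_transpose, Matrix.mul_assoc,
      Matrix.trace_mul_comm]
  have h2 : contr (B.transpose * B * S * (B.transpose * B)) S = (W.transpose * W).trace := by
    rw [contr_eq_trace]
    simp only [hW, Matrix.transpose_mul, Matrix.transpose_transpose]
    simp only [Matrix.mul_assoc]
    rw [Matrix.trace_mul_comm]
    simp only [Matrix.mul_assoc]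
  rw [h1, h2]
  calc W.trace ^ 2 ≤ (Finset.univ : Finset (Fin n)).card * ∑ i, W i i ^ 2 :=
        sq_sum_le_card_mul_sum_sq
    _ ≤ n * (W.transpose * W).trace := by
        rw [Finset.card_univ, Fintype.card_fin]
        refine mul_le_mul_of_nonneg_left ?_ (Nat.cast_nonneg _)
        simp only [Matrix.trace, Matrix.diag, Matrix.mul_apply, Matrix.transpose_apply, ← sq]
        exact Finset.sum_le_sum fun i _ =>
          Finset.single_le_sum (f := fun j => W j i ^ 2) (fun j _ => sq_nonneg _)
            (Finset.mem_univ i)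

/-- The second derivative is nonnegative at a local minimum. -/
theorem snd_deriv_nonneg_of_isLocalMin {E : Type*} [NormedAddCommGroup E] [NormedSpace ℝ E]
    {f : E → ℝ} {y : E} (hf : ContDiffAt ℝ 2 f y) (hmin : IsLocalMin f y) (v : E) :
    0 ≤ fderiv ℝ (fderiv ℝ f) y v v := by
  set l : ℝ → E := fun s => y + s • v with hl
  have hl' : ∀ s, HasDerivAt l v s := fun s => by
    have := ((hasDerivAt_id s).smul_const v).const_add y
    rw [one_smul] at this
    exact this
  have hl0 : l 0 = y := by simp [hl]
  have hlc : Filter.Tendsto l (nhds 0) (nhds y) := by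
    have := (hl' 0).continuousAt.tendsto
    rwa [hl0] at this
  have hev : ∀ᶠ z in nhds y, DifferentiableAt ℝ f z :=
    (hf.eventually (by simp)).mono fun z hz => hz.differentiableAt (by simp)
  have hd1 : deriv (f ∘ l) =ᶠ[nhds 0] fun s => fderiv ℝ f (l s) v := by
    filter_upwards [hlc.eventually hev] with s hs
    exact (hs.hasFDerivAt.comp_hasDerivAt s (hl' s)).deriv
  have hd2 : deriv (deriv (f ∘ l)) 0 = fderiv ℝ (fderiv ℝ f) y v v := by
    rw [hd1.deriv_eq]
    have h2 : HasFDerivAt (fderiv ℝ f) (fderiv ℝ (fderiv ℝ f) y) (l 0) := by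
      rw [hl0]
      exact ((hf.fderiv_right (m := 1) (by norm_num)).differentiableAt (by simp)).hasFDerivAt
    have h3 := (h2.comp_hasDerivAt (0 : ℝ) (hl' 0)).clm_apply (hasDerivAt_const (0 : ℝ) v)
    simpa using h3.deriv
  have hmin' : IsLocalMin (f ∘ l) 0 := by
    have := hlc.eventually hmin
    filter_upwards [this] with s hs
    simpa [hl0] using hs
  by_contra hneg
  rw [not_le, ← hd2] at hneg
  have hcont : ContinuousAt (f ∘ l) 0 := by
    refine ContinuousAt.comp ?_ (hl' 0).continuousAt
    rw [hl0]; exact hf.continuousAt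
  -- A negative second derivative would make the point also a local maximum along the line, so the
  -- function would be locally constant there and its second derivative zero.
  have hmax := isLocalMax_of_deriv_deriv_neg hneg hmin'.deriv_eq_zero hcont
  have hconst : (f ∘ l) =ᶠ[nhds 0] fun _ => (f ∘ l) 0 := by
    filter_upwards [hmin', hmax] with s h1 h2 using le_antisymm h2 h1
  have : deriv (f ∘ l) =ᶠ[nhds 0] deriv fun _ => (f ∘ l) 0 := hconst.deriv
  rw [this.deriv_eq] at hneg
  simp at hneg

theorem partialDeriv_partialDeriv {f : Model n → ℝ} {y : Model n} (hf : ContDiffAt ℝ 2 f y)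
    (i l : Fin n) : partialDeriv i (partialDeriv l f) y
      = fderiv ℝ (fderiv ℝ f) y (EuclideanSpace.single i 1) (EuclideanSpace.single l 1) := by
  have h2 : HasFDerivAt (fderiv ℝ f) (fderiv ℝ (fderiv ℝ f) y) y :=
    ((hf.fderiv_right (m := 1) (by norm_num)).differentiableAt (by simp)).hasFDerivAt
  have h3 := h2.clm_apply (hasFDerivAt_const (EuclideanSpace.single l (1 : ℝ) : Model n) y)
  have h4 : partialDeriv l f = fun z => fderiv ℝ f z (EuclideanSpace.single l 1) := rfl
  rw [h4, partialDeriv, h3.fderiv]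
  simp

/-- At a local minimum, the trace of the Hessian against a positive matrix is nonnegative. -/
theorem trace_hessian_nonneg {f : Model n → ℝ} {y : Model n} (hf : ContDiffAt ℝ 2 f y)
    (hmin : IsLocalMin f y) {H : Matrix (Fin n) (Fin n) ℝ} (hH : H.PosSemidef) :
    0 ≤ ∑ i, ∑ l, H i l * partialDeriv i (partialDeriv l f) y := by
  obtain ⟨B, rfl⟩ := exists_transpose_mul_self hH
  set Q := fderiv ℝ (fderiv ℝ f) y with hQ
  -- With H = BᵀB the trace is a sum of second derivatives in the directions given by the rows of B.
  have key : ∑ i, ∑ l, (B.transpose * B) i l * partialDeriv i (partialDeriv l f) y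
      = ∑ c, Q (∑ i, B c i • (EuclideanSpace.single i 1 : Model n))
          (∑ i, B c i • (EuclideanSpace.single i 1 : Model n)) := by
    simp only [partialDeriv_partialDeriv hf, ← hQ, map_sum, map_smul,
      sum_apply, smul_apply, smul_eq_mul,
      Matrix.mul_apply, Matrix.transpose_apply, Finset.sum_mul, Finset.mul_sum]
    have : ∀ i, ∑ l, ∑ c, B c i * B c l
          * Q (EuclideanSpace.single i 1) (EuclideanSpace.single l 1)
        = ∑ c, ∑ l, B c i * B c l
          * Q (EuclideanSpace.single i 1) (EuclideanSpace.single l 1) := fun _ => Finset.sum_comm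
    simp only [this]
    rw [Finset.sum_comm]
    refine Finset.sum_congr rfl fun c _ => ?_
    rw [Finset.sum_comm]
    exact Finset.sum_congr rfl fun i _ => Finset.sum_congr rfl fun l _ => by ring
  rw [key]
  exact Finset.sum_nonneg fun c _ => snd_deriv_nonneg_of_isLocalMin hf hmin _

end Pointwise

/-! ### Consequences for metrics on a region of `ℝⁿ` -/

section Region

variable {n : ℕ} {J : Set ℝ} {U : Set (Model n)}
variable {G : ℝ → Model n → Matrix (Fin n) (Fin n) ℝ}

theorem contDiffOn_scal (hJ : UniqueDiffOn ℝ J) (hU : IsOpen U)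
    (hG : ∀ i j, ContDiffOn ℝ ∞ (fun q : ℝ × Model n => G q.1 q.2 i j) (J ×ˢ U))
    (hdet : ∀ t ∈ J, ∀ y ∈ U, (G t y).det ≠ 0) :
    ContDiffOn ℝ ∞ (fun q : ℝ × Model n => scal (G q.1) q.2) (J ×ˢ U) := by
  have hS : UniqueDiffOn ℝ (J ×ˢ U) := hJ.prod hU.uniqueDiffOn
  have hg := metricMat_isUnit (hG := hG) hdet
  refine (contDiffOn_smoothRep (contr (metricMat G hG)⁻¹
    (ric (spaceDeriv hS) (conn (spaceDeriv hS) (metricMat G hG))))).congr ?_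
  rintro ⟨t, y⟩ ⟨ht, hy⟩
  exact (scal_eq hS hU hg ht hy).trans (smoothRep_apply _ (stPoint ht hy)).symm

theorem contDiffOn_slice {F : ℝ × Model n → ℝ} (hF : ContDiffOn ℝ ∞ F (J ×ˢ U)) {t : ℝ}
    (ht : t ∈ J) : ContDiffOn ℝ ∞ (fun y => F (t, y)) U :=
  hF.comp (t := J ×ˢ U) (contDiff_const.prodMk contDiff_id).contDiffOn fun _ hy => ⟨ht, hy⟩

/-- At a spatial local minimum, the scalar curvature of a Ricci flow satisfies
`∂R/∂t ≥ (2/n) R²`. -/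
theorem scal_evolution_at_min (hJ : UniqueDiffOn ℝ J) (hJ' : J ⊆ closure (interior J))
    (hU : IsOpen U)
    (hG : ∀ i j, ContDiffOn ℝ ∞ (fun q : ℝ × Model n => G q.1 q.2 i j) (J ×ˢ U))
    (hpos : ∀ t ∈ J, ∀ y ∈ U, (G t y).PosDef)
    (hflow : ∀ t ∈ J, ∀ y ∈ U, ∀ i j,
      HasDerivWithinAt (fun s => G s y i j) (-2 * ricci (G t) i j y) J t)
    {t : ℝ} {y : Model n} (ht : t ∈ J) (hy : y ∈ U) (hmin : IsLocalMin (scal (G t)) y) :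
    ∃ r, HasDerivWithinAt (fun s => scal (G s) y) r J t ∧ 2 * scal (G t) y ^ 2 ≤ n * r := by
  have hS : UniqueDiffOn ℝ (J ×ˢ U) := hJ.prod hU.uniqueDiffOn
  have hS' : J ×ˢ U ⊆ closure (interior (J ×ˢ U)) := by
    rw [interior_prod_eq, closure_prod_eq, hU.interior_eq]
    exact Set.prod_mono hJ' subset_closure
  have hdet : ∀ t ∈ J, ∀ y ∈ U, (G t y).det ≠ 0 := fun t ht y hy => (hpos t ht y hy).det_pos.ne'
  have hg := metricMat_isUnit (hG := hG) hdet
  have hs : (metricMat G hG).transpose = metricMat G hG := by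
    refine Matrix.ext fun i j => smoothFn.ext' fun q => ?_
    have := (hpos _ q.2.1 _ q.2.2).isHermitian
    exact congrFun (congrFun this i) j
  set D := spaceDeriv (n := n) hS with hD
  set g := metricMat G hG with hgdef
  have hfl : matDeriv (timeDeriv hS) g = (-2 : ℝ) • ric D (conn D g) := by
    refine Matrix.ext fun i j => smoothFn.ext' fun q => ?_
    obtain ⟨⟨t, y⟩, ht, hy⟩ := q
    have h1 := timeDeriv_hasDerivWithinAt hS (g i j) ht hy (φ := fun s => G s y i j)
      fun s hs => rfl
    -- Derivatives within J are unique, so the flow equation becomes an identity in the ring of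
    -- smooth functions.
    have h2 := (hJ t ht).eq_deriv J h1 (hflow t ht y hy i j)
    rw [ricci_eq hS hU hg i j ht hy] at h2
    exact h2
  have hev := scalar_evolution (D := D) (T := timeDeriv hS)
    (fun i j a => dirDeriv_comm hS hS' _ _ a) (fun i a => dirDeriv_comm hS hS' _ _ a) hg hs hfl
  set R := contr g⁻¹ (ric D (conn D g)) with hR
  have hsc : ∀ z (hz : z ∈ U), scal (G t) z = R.1 (stPoint ht hz) := fun z hz =>
    scal_eq hS hU hg ht hz
  refine ⟨(timeDeriv hS R).1 (stPoint ht hy), timeDeriv_hasDerivWithinAt hS R ht hy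
    fun s hs => scal_eq hS hU hg hs hy, ?_⟩
  have hsmooth : ContDiffAt ℝ ∞ (scal (G t)) y :=
    (contDiffOn_slice (contDiffOn_scal hJ hU hG hdet) ht).contDiffAt (hU.mem_nhds hy)
  -- The gradient vanishes at the minimum, so the terms of the Laplacian containing Γ or derivatives
  -- of g⁻¹ drop out, leaving the Hessian traced with g⁻¹.
  have hD1 : ∀ l, smoothFn.eval (stPoint ht hy) (D l R) = 0 := fun l => by
    rw [smoothFn.eval_apply, hD, spaceDeriv_apply hS hU l R ht hy hsc, partialDeriv,
      hmin.fderiv_eq_zero]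
    rfl
  have hD2 : ∀ i l, smoothFn.eval (stPoint ht hy) (D i (D l R))
      = partialDeriv i (partialDeriv l (scal (G t))) y := fun i l => by
    rw [smoothFn.eval_apply, hD]
    exact spaceDeriv_apply hS hU i _ ht hy fun z hz =>
      (spaceDeriv_apply hS hU l R ht hz hsc).symm
  have hH : ∀ i l, smoothFn.eval (stPoint ht hy) (g⁻¹ i l) = (G t y)⁻¹ i l := fun i l =>
    metricMat_inv_apply hg i l _
  set Rc : Matrix (Fin n) (Fin n) ℝ := (ric D (conn D g)).map (smoothFn.eval (stPoint ht hy))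
    with hRc
  have hHm : g⁻¹.map (smoothFn.eval (stPoint ht hy)) = (G t y)⁻¹ := by ext i l; exact hH i l
  have hcontr : ∀ M N : Matrix (Fin n) (Fin n) (smoothFn (J ×ˢ U)),
      smoothFn.eval (stPoint ht hy) (contr M N)
        = contr (M.map (smoothFn.eval (stPoint ht hy)))
          (N.map (smoothFn.eval (stPoint ht hy))) := fun M N => by
    simp only [contr, map_sum, map_mul, Matrix.map_apply]
  have hval : scal (G t) y = contr (G t y)⁻¹ Rc := by
    rw [hsc y hy, ← smoothFn.eval_apply, hR, hcontr, hHm]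
  have hr := congrArg (smoothFn.eval (stPoint ht hy)) hev
  rw [smoothFn.eval_apply] at hr
  rw [hr]
  simp only [map_add, map_sum, map_mul, Derivation.leibniz, smul_eq_mul, hD1, hD2, hH, mul_zero,
    zero_mul, add_zero, Finset.sum_const_zero, hcontr, Matrix.map_mul, hHm, map_ofNat]
  rw [← hRc, hval]
  have hps : ((G t y)⁻¹).PosSemidef := (hpos t ht y hy).inv.posSemidef
  have h1 := contr_sq_le hps Rc
  have h2 := trace_hessian_nonneg (hsmooth.of_le (WithTop.coe_le_coe.2 (le_top : (2 : ℕ∞) ≤ ⊤))) hmin hps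
  have h3 : (0 : ℝ) ≤ n := Nat.cast_nonneg n
  nlinarith [mul_nonneg h3 h2]

end Region

/-! ### Invariance of the scalar curvature under smooth coordinate changes -/

section CoordinateChange

variable {n : ℕ} {U U' : Set (Model n)}

/-- The Jacobian matrix of a map between regions of `ℝⁿ`. -/
def jacobian (φ : Model n → Model n) (y : Model n) : Matrix (Fin n) (Fin n) ℝ :=
  Matrix.of fun a i => fderiv ℝ φ y (EuclideanSpace.single i 1) a

theorem fderiv_single_eq_sum (φ : Model n → Model n) (y : Model n) (i : Fin n) :
    fderiv ℝ φ y (EuclideanSpace.single i 1)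
      = ∑ a, jacobian φ y a i • (EuclideanSpace.single a 1 : Model n) := by
  ext b
  simp [jacobian, Finset.sum_apply, Pi.single_apply]

theorem contDiffOn_prodMap {φ : Model n → Model n} (hφ : ContDiffOn ℝ ∞ φ U') :
    ContDiffOn ℝ ∞ (fun q : ℝ × Model n => (q.1, φ q.2)) (Set.univ ×ˢ U') :=
  contDiff_fst.contDiffOn.prodMk (hφ.comp contDiff_snd.contDiffOn fun _ hq => hq.2)

/-- Pullback of smooth functions by a smooth map. -/
def pullback (φ : Model n → Model n) (hφ : ContDiffOn ℝ ∞ φ U') (hm : Set.MapsTo φ U' U) :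
    smoothFn ((Set.univ : Set ℝ) ×ˢ U) →+* smoothFn ((Set.univ : Set ℝ) ×ˢ U') where
  toFun f := ⟨fun q => f.1 ⟨(q.1.1, φ q.1.2), trivial, hm q.2.2⟩,
    fun q => smoothRep f (q.1, φ q.2),
    (contDiffOn_smoothRep f).comp (contDiffOn_prodMap hφ) fun _ hq => ⟨trivial, hm hq.2⟩,
    fun q => smoothRep_apply f ⟨(q.1.1, φ q.1.2), trivial, hm q.2.2⟩⟩
  map_one' := rfl
  map_mul' _ _ := rfl
  map_zero' := rfl
  map_add' _ _ := rfl

/-- The scalar curvature is invariant under changes of coordinates. -/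
theorem scal_comp (hU : IsOpen U) (hU' : IsOpen U') {φ : Model n → Model n}
    (hφ : ContDiffOn ℝ ∞ φ U') (hm : Set.MapsTo φ U' U)
    {G G' : Model n → Matrix (Fin n) (Fin n) ℝ}
    (hG : ∀ i j, ContDiffOn ℝ ∞ (fun y => G y i j) U)
    (hG' : ∀ i j, ContDiffOn ℝ ∞ (fun y => G' y i j) U')
    (hdet : ∀ y ∈ U, (G y).det ≠ 0) (hdet' : ∀ y ∈ U', (G' y).det ≠ 0)
    (hs : ∀ y ∈ U, (G y).transpose = G y)
    (h : ∀ y ∈ U', G' y = (jacobian φ y).transpose * G (φ y) * jacobian φ y) {y : Model n}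
    (hy : y ∈ U') : scal G' y = scal G (φ y) := by
  -- A dummy time factor ℝ lets the space-time ring serve for a single metric.
  have hS : UniqueDiffOn ℝ ((Set.univ : Set ℝ) ×ˢ U) := uniqueDiffOn_univ.prod hU.uniqueDiffOn
  have hS' : UniqueDiffOn ℝ ((Set.univ : Set ℝ) ×ˢ U') := uniqueDiffOn_univ.prod hU'.uniqueDiffOn
  have hO' : IsOpen ((Set.univ : Set ℝ) ×ˢ U') := isOpen_univ.prod hU'
  have hGt : ∀ i j, ContDiffOn ℝ ∞ (fun q : ℝ × Model n => (fun _ : ℝ => G) q.1 q.2 i j)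
      (Set.univ ×ˢ U) := fun i j => (hG i j).comp contDiff_snd.contDiffOn fun _ hq => hq.2
  have hGt' : ∀ i j, ContDiffOn ℝ ∞ (fun q : ℝ × Model n => (fun _ : ℝ => G') q.1 q.2 i j)
      (Set.univ ×ˢ U') := fun i j => (hG' i j).comp contDiff_snd.contDiffOn fun _ hq => hq.2
  have hg := metricMat_isUnit (hG := hGt) fun t _ y hy => hdet y hy
  have hg' := metricMat_isUnit (hG := hGt') fun t _ y hy => hdet' y hy
  have hJsm : ∀ a i, ContDiffOn ℝ ∞ (fun q : ℝ × Model n => jacobian φ q.2 a i)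
      (Set.univ ×ˢ U') := fun a i => by
    have h1 : ContDiffOn ℝ ∞ (fun z => fderiv ℝ φ z (EuclideanSpace.single i 1)) U' :=
      (hφ.fderiv_of_isOpen hU' (m := ∞) (by simp)).clm_apply contDiffOn_const
    have h2 : ContDiffOn ℝ ∞ (fun z => jacobian φ z a i) U' :=
      (EuclideanSpace.proj (𝕜 := ℝ) a).contDiff.comp_contDiffOn h1
    exact h2.comp contDiff_snd.contDiffOn fun _ hq => hq.2
  set J : Matrix (Fin n) (Fin n) (smoothFn ((Set.univ : Set ℝ) ×ˢ U')) :=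
    Matrix.of fun a i => smoothFn.mk _ (hJsm a i) with hJ
  -- Invertibility of the Jacobian comes from the nondegeneracy of the pulled back metric, so no
  -- inverse map is required.
  have hJdet : IsUnit J.det := by
    refine smoothFn.isUnit fun q => ?_
    rw [← smoothFn.eval_apply, RingHom.map_det]
    have h1 : (J.map (smoothFn.eval q)) = jacobian φ q.1.2 := rfl
    have h2 := hdet' _ q.2.2
    rw [h _ q.2.2, Matrix.det_mul] at h2
    rw [RingHom.mapMatrix_apply, h1]
    exact right_ne_zero_of_mul h2
  have hdiff : ∀ z ∈ U', DifferentiableAt ℝ φ z := fun z hz =>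
    (hφ.contDiffAt (hU'.mem_nhds hz)).differentiableAt (by simp)
  have hcomp : ∀ a, ContDiffOn ℝ ∞ (fun q : ℝ × Model n => φ q.2 a) (Set.univ ×ˢ U') := fun a =>
    ((EuclideanSpace.proj (𝕜 := ℝ) a).contDiff.comp_contDiffOn hφ).comp contDiff_snd.contDiffOn
      fun _ hq => hq.2
  have hJd : ∀ a i, J a i = spaceDeriv hS' i (smoothFn.mk _ (hcomp a)) := fun a i => by
    refine smoothFn.ext' fun q => ?_
    obtain ⟨⟨t, y⟩, ht, hy⟩ := q
    rw [spaceDeriv_apply hS' hU' i _ ht hy (φ := fun z => φ z a) fun z hz => rfl]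
    have h1 : HasFDerivAt (fun z => φ z a)
        ((EuclideanSpace.proj (𝕜 := ℝ) a).comp (fderiv ℝ φ y)) y :=
      (EuclideanSpace.proj (𝕜 := ℝ) a).hasFDerivAt.comp y (hdiff y hy).hasFDerivAt
    rw [partialDeriv, h1.fderiv]
    rfl
  have key := scalar_pullback (D := spaceDeriv (n := n) hS) (E := spaceDeriv (n := n) hS')
    (pullback φ hφ hm)
    (fun i j b => dirDeriv_comm hS' (by rw [hO'.interior_eq]; exact subset_closure) _ _ b) hJdet
    (fun i j a => by
      rw [hJd, hJd]
      exact dirDeriv_comm hS' (by rw [hO'.interior_eq]; exact subset_closure) _ _ _)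
    (fun i a => by
      refine smoothFn.ext' fun q => ?_
      obtain ⟨⟨t, y⟩, ht, hy⟩ := q
      set ψ : Model n → ℝ := fun z => smoothRep a (t, z) with hψ
      have hψa : ∀ z (hz : z ∈ U), ψ z = a.1 ⟨(t, z), ht, hz⟩ := fun z hz =>
        smoothRep_apply a ⟨(t, z), ht, hz⟩
      rw [spaceDeriv_apply hS' hU' i (pullback φ hφ hm a) ht hy (φ := ψ ∘ φ)
        fun z hz => hψa _ (hm hz)]
      rw [← smoothFn.eval_apply, map_sum]
      have hψd : DifferentiableAt ℝ ψ (φ y) :=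
        ((contDiffOn_slice (contDiffOn_smoothRep a) ht).contDiffAt
          (hU.mem_nhds (hm hy))).differentiableAt (by simp)
      rw [partialDeriv, fderiv_comp y hψd (hdiff y hy), ContinuousLinearMap.comp_apply,
        fderiv_single_eq_sum, map_sum]
      refine Finset.sum_congr rfl fun c _ => ?_
      rw [map_smul, map_mul, smul_eq_mul]
      congr 1
      exact (spaceDeriv_apply hS hU c a ht (hm hy) hψa).symm)
    hg (by
      refine Matrix.ext fun i j => smoothFn.ext' fun q => ?_
      exact congrFun (congrFun (hs _ q.2.2) i) j)
    (g' := metricMat (fun _ => G') hGt') (by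
      refine Matrix.ext fun i j => smoothFn.ext' fun q => ?_
      have h1 := congrFun (congrFun (h _ q.2.2) i) j
      have h2 : smoothFn.eval q ((J.transpose * (metricMat (fun _ => G) hGt).map (pullback φ hφ hm)
          * J) i j) = ((jacobian φ q.1.2).transpose * G (φ q.1.2) * jacobian φ q.1.2) i j := by
        simp only [Matrix.mul_apply, map_sum, map_mul]
        rfl
      exact h1.trans h2.symm)
  have h1 := scal_eq hS' hU' hg' (t := 0) trivial hy
  rw [key] at h1
  exact h1.trans (scal_eq hS hU hg (t := 0) trivial (hm hy)).symm

end CoordinateChange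

/-! ### Scalar curvature in a fixed chart -/

section Chart

variable {n : ℕ} {M : Type*} [TopologicalSpace M] [ChartedSpace (Model n) M]
  [IsManifold (𝓡 n) ∞ M]

/-- All tangent spaces are definitionally the model space, so the same vectors can be compared at
base points that are only propositionally equal. -/
theorem Metric.inner_congr (g : Metric n M) {z z' : M} (h : z = z')
    (u v : Model n) :
    g.inner z (u : TangentSpace (𝓡 n) z) (v : TangentSpace (𝓡 n) z)
      = g.inner z' (u : TangentSpace (𝓡 n) z') (v : TangentSpace (𝓡 n) z') := by
  subst h; rfl

/-- The differential of the inverse of the chart around `p`. -/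
def chartSymmDeriv (p : M) (y : Model n) :
    Model n →L[ℝ] TangentSpace (𝓡 n) ((extChartAt (𝓡 n) p).symm y) :=
  mfderiv 𝓘(ℝ, Model n) (𝓡 n) (extChartAt (𝓡 n) p).symm y

theorem chartSymmDeriv_injective (p : M) {y : Model n} (hy : y ∈ (extChartAt (𝓡 n) p).target) :
    Function.Injective (chartSymmDeriv (n := n) p y) := by
  have : IsManifold (𝓡 n) 1 M := IsManifold.of_le (n := ∞) (by simp)
  have h := mfderiv_extChartAt_comp_mfderivWithin_extChartAt_symm hy
  have hr : Set.range (𝓡 n) = Set.univ := by simp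
  rw [hr, mfderivWithin_univ] at h
  intro u v huv
  have key : ∀ u : Model n, mfderiv (𝓡 n) 𝓘(ℝ, Model n) (extChartAt (𝓡 n) p)
      ((extChartAt (𝓡 n) p).symm y) (chartSymmDeriv p y u) = u := fun u => DFunLike.congr_fun h u
  rw [← key u, huv, key v]

theorem Metric.coord_apply (g : Metric n M) (p : M) (y : Model n) (i j : Fin n) :
    g.coord p y i j = g.inner ((extChartAt (𝓡 n) p).symm y)
      (chartSymmDeriv p y (EuclideanSpace.single i 1))
      (chartSymmDeriv p y (EuclideanSpace.single j 1)) := rfl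

theorem Metric.coord_posDef (g : Metric n M) (p : M) {y : Model n}
    (hy : y ∈ (extChartAt (𝓡 n) p).target) : (g.coord p y).PosDef := by
  refine Matrix.PosDef.of_dotProduct_mulVec_pos ?_ ?_
  · ext i j
    exact g.symm _ _ _
  · intro v hv
    set w : Model n := ∑ i, v i • (EuclideanSpace.single i 1 : Model n) with hw
    have hwv : ∀ i, w i = v i := fun i => by
      simp [hw, Finset.sum_apply, Pi.single_apply]
    have hw0 : w ≠ 0 := fun h0 => hv (funext fun i => by rw [← hwv, h0]; rfl)
    have key : star v ⬝ᵥ (g.coord p y).mulVec v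
        = g.inner ((extChartAt (𝓡 n) p).symm y) (chartSymmDeriv p y w)
          (chartSymmDeriv p y w) := by
      simp only [hw, map_sum, map_smul, sum_apply, smul_apply, smul_eq_mul, dotProduct,
        Matrix.mulVec, star_trivial, g.coord_apply, Finset.mul_sum]
      rw [Finset.sum_comm]
      exact Finset.sum_congr rfl fun i _ => Finset.sum_congr rfl fun j _ => by ring
    rw [key]
    refine g.pos _ _ fun h0 => hw0 (chartSymmDeriv_injective p hy ?_)
    rw [h0, map_zero]

/-- The domain of the transition map from the chart around `x` to the chart around `p`. -/
def overlap (p x : M) : Set (Model n) :=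
  ((extChartAt (𝓡 n) x).symm.trans (extChartAt (𝓡 n) p)).source

/-- The transition map from the chart around `x` to the chart around `p`. -/
def transition (p x : M) : Model n → Model n :=
  extChartAt (𝓡 n) p ∘ (extChartAt (𝓡 n) x).symm

theorem isOpen_overlap (p x : M) : IsOpen (overlap (n := n) p x) :=
  (continuousOn_extChartAt_symm x).isOpen_inter_preimage (isOpen_extChartAt_target x)
    (isOpen_extChartAt_source p)

theorem mapsTo_transition (p x : M) :
    Set.MapsTo (transition (n := n) p x) (overlap p x) (extChartAt (𝓡 n) p).target :=
  fun _ hy => (extChartAt (𝓡 n) p).map_source hy.2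

theorem chartSymm_transition (p x : M) {y : Model n} (hy : y ∈ overlap p x) :
    (extChartAt (𝓡 n) p).symm (transition p x y) = (extChartAt (𝓡 n) x).symm y :=
  (extChartAt (𝓡 n) p).left_inv hy.2

/-- Chain rule: the inverse chart at x is the inverse chart at p after the transition map, so the
coordinate fields are related by its Jacobian. -/
theorem Metric.coord_transition (g : Metric n M) (p x : M) {y : Model n}
    (hy : y ∈ overlap p x) :
    g.coord x y = (jacobian (transition p x) y).transpose * g.coord p (transition p x y)
      * jacobian (transition p x) y := by
  have hφ : DifferentiableAt ℝ (transition (n := n) p x) y :=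
    ((contDiffOn_ext_coord_change (n := ∞) (I := 𝓡 n) p x).contDiffAt
      ((isOpen_overlap p x).mem_nhds hy)).differentiableAt (by simp)
  have hp : MDifferentiableAt 𝓘(ℝ, Model n) (𝓡 n) (extChartAt (𝓡 n) p).symm
      (transition p x y) :=
    ((contMDiffOn_extChartAt_symm (n := ∞) (I := 𝓡 n) p).contMDiffAt
      ((isOpen_extChartAt_target p).mem_nhds (mapsTo_transition p x hy))).mdifferentiableAt
        (by simp)
  have hd : HasMFDerivAt 𝓘(ℝ, Model n) (𝓡 n) (extChartAt (𝓡 n) x).symm y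
      ((mfderiv 𝓘(ℝ, Model n) (𝓡 n) (extChartAt (𝓡 n) p).symm (transition p x y)).comp
        (fderiv ℝ (transition p x) y)) := by
    refine (HasMFDerivAt.comp y hp.hasMFDerivAt
      hφ.hasFDerivAt.hasMFDerivAt).congr_of_eventuallyEq ?_
    filter_upwards [(isOpen_overlap p x).mem_nhds hy] with z hz
    exact (chartSymm_transition p x hz).symm
  have hz := chartSymm_transition p x hy
  have hvec : ∀ i, chartSymmDeriv x y (EuclideanSpace.single i 1)
      = chartSymmDeriv p (transition p x y)
        (fderiv ℝ (transition p x) y (EuclideanSpace.single i 1)) := fun i =>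
    DFunLike.congr_fun hd.mfderiv (EuclideanSpace.single i (1 : ℝ) : Model n)
  ext i j
  have h1 : g.coord x y i j = g.inner ((extChartAt (𝓡 n) p).symm (transition p x y))
      (chartSymmDeriv p (transition p x y)
        (fderiv ℝ (transition p x) y (EuclideanSpace.single i 1)))
      (chartSymmDeriv p (transition p x y)
        (fderiv ℝ (transition p x) y (EuclideanSpace.single j 1))) := by
    rw [g.coord_apply, hvec i, hvec j]
    exact (g.inner_congr hz _ _).symm
  rw [h1, fderiv_single_eq_sum, fderiv_single_eq_sum]
  simp only [map_sum, map_smul, sum_apply, smul_apply, smul_eq_mul, Matrix.mul_apply,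
    Matrix.transpose_apply, g.coord_apply, Finset.sum_mul, Finset.mul_sum]
  refine Finset.sum_congr rfl fun a _ => Finset.sum_congr rfl fun b _ => ?_
  ring

/-- The definition uses a chart that changes with x; this replaces it by one fixed chart, as
continuity and spatial differentiation of R require. -/
theorem Metric.scalarCurvature_eq (g : Metric n M)
    (hg : ∀ (p : M) (i j : Fin n),
      ContDiffOn ℝ ∞ (fun y => g.coord p y i j) (extChartAt (𝓡 n) p).target)
    (p : M) {x : M} (hx : x ∈ (extChartAt (𝓡 n) p).source) :
    g.scalarCurvature x = scal (g.coord p) (extChartAt (𝓡 n) p x) := by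
  have hxy : (extChartAt (𝓡 n) x).symm (extChartAt (𝓡 n) x x) = x := extChartAt_to_inv x
  have hy : extChartAt (𝓡 n) x x ∈ overlap (n := n) p x := by
    refine ⟨mem_extChartAt_target x, ?_⟩
    rw [Set.mem_preimage]
    exact hxy.symm ▸ hx
  have h := scal_comp (isOpen_extChartAt_target p) (isOpen_overlap p x)
    (contDiffOn_ext_coord_change (n := ∞) (I := 𝓡 n) p x) (mapsTo_transition p x)
    (G := g.coord p) (G' := g.coord x) (hg p) (fun i j => (hg x i j).mono fun _ h => h.1)
    (fun y hy => (g.coord_posDef p hy).det_pos.ne')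
    (fun y hy => (g.coord_posDef x hy.1).det_pos.ne')
    (fun y hy => (g.coord_posDef p hy).isHermitian)
    (fun y hy => g.coord_transition p x hy) hy
  rw [Metric.scalarCurvature, h]
  simp only [Function.comp_apply]
  rw [hxy]

end Chart

/-! ### The minimum principle -/

/-- At a negative space-time minimum of the weighted difference e^{-Ct}(F - ρ), the factorisation F²
- ρ² = (F - ρ)(F + ρ) makes the time derivative strictly positive once C exceeds c(F + ρ). The
values just before would then be smaller still. -/
theorem min_principle {M : Type*} [TopologicalSpace M] [CompactSpace M] {F : ℝ → M → ℝ} {T : ℝ}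
    (hF : ContinuousOn (fun q : ℝ × M => F q.1 q.2) (Set.Icc 0 T ×ˢ Set.univ)) {c : ℝ}
    (hev : ∀ t ∈ Set.Icc 0 T, ∀ x, (∀ x', F t x ≤ F t x') →
      ∃ r, HasDerivWithinAt (fun s => F s x) r (Set.Icc 0 T) t ∧ c * F t x ^ 2 ≤ r)
    {ρ : ℝ → ℝ} (hρ : ∀ t ∈ Set.Icc 0 T, HasDerivWithinAt ρ (c * ρ t ^ 2) (Set.Icc 0 T) t)
    (h0 : ∀ x, ρ 0 ≤ F 0 x) : ∀ t ∈ Set.Icc 0 T, ∀ x, ρ t ≤ F t x := by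
  intro t ht x
  by_contra hlt
  rw [not_le] at hlt
  have hK : IsCompact (Set.Icc 0 T ×ˢ (Set.univ : Set M)) := isCompact_Icc.prod isCompact_univ
  have hρc : ContinuousOn (fun q : ℝ × M => ρ q.1) (Set.Icc 0 T ×ˢ Set.univ) :=
    ContinuousOn.comp (t := Set.Icc 0 T) (fun s hs => (hρ s hs).continuousWithinAt)
      continuousOn_fst fun q hq => hq.1
  obtain ⟨C₀, hC₀⟩ := hK.exists_bound_of_continuousOn
    ((hF.add hρc).const_smul c)
  -- The extra 1 makes the bound on c(F + ρ) strict.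
  set C := C₀ + 1 with hC
  have hbound : ∀ s ∈ Set.Icc 0 T, ∀ z, c * (F s z + ρ s) < C := fun s hs z => by
    have h1 := hC₀ (s, z) ⟨hs, trivial⟩
    have h2 := (le_abs_self _).trans h1
    simp only [Pi.smul_apply, Pi.add_apply, smul_eq_mul] at h2
    linarith
  set w : ℝ × M → ℝ := fun q => Real.exp (-C * q.1) * (F q.1 q.2 - ρ q.1) with hw
  have hwc : ContinuousOn w (Set.Icc 0 T ×ˢ Set.univ) := by
    refine ContinuousOn.mul (Continuous.continuousOn ?_) (hF.sub hρc)
    fun_prop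
  obtain ⟨⟨t₂, x₂⟩, ⟨ht₂, -⟩, hmin⟩ := hK.exists_isMinOn ⟨(t, x), ht, trivial⟩ hwc
  have hmin' : ∀ s ∈ Set.Icc 0 T, ∀ z, w (t₂, x₂) ≤ w (s, z) := fun s hs z =>
    hmin (a := (s, z)) ⟨hs, trivial⟩
  have hneg : w (t₂, x₂) < 0 := (hmin' t ht x).trans_lt
    (mul_neg_of_pos_of_neg (Real.exp_pos _) (sub_neg.2 hlt))
  have hFρ : F t₂ x₂ - ρ t₂ < 0 := by
    by_contra h
    exact absurd hneg (not_lt.2 (mul_nonneg (Real.exp_pos _).le (not_lt.1 h)))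
  have ht₂pos : 0 < t₂ := by
    rcases ht₂.1.eq_or_lt with h | h
    · change 0 = t₂ at h
      rw [← h] at hFρ
      linarith [h0 x₂]
    · exact h
  have hsp : ∀ x', F t₂ x₂ ≤ F t₂ x' := fun x' => by
    have := le_of_mul_le_mul_left (hmin' t₂ ht₂ x') (Real.exp_pos _)
    simpa using this
  obtain ⟨r, hr, hrle⟩ := hev t₂ ht₂ x₂ hsp
  have hexp : HasDerivWithinAt (fun s => Real.exp (-C * s)) (Real.exp (-C * t₂) * (-C * 1))
      (Set.Icc 0 T) t₂ := (((hasDerivAt_id t₂).const_mul (-C)).exp).hasDerivWithinAt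
  have hder := hexp.mul (hr.sub (hρ t₂ ht₂))
  have hloc : IsLocalMinOn (fun s => w (s, x₂)) (Set.Icc 0 T) t₂ := by
    filter_upwards [self_mem_nhdsWithin] with s hs using hmin' s hs x₂
  -- Only the backward direction is used, since the minimum may occur at the final time T.
  have hcone : (0 : ℝ) - t₂ ∈ posTangentConeAt (Set.Icc 0 T) t₂ :=
    sub_mem_posTangentConeAt_of_segment_subset
      ((convex_Icc 0 T).segment_subset ht₂ ⟨le_rfl, ht₂.1.trans ht₂.2⟩)
  have hge := hloc.hasFDerivWithinAt_nonneg hder.hasFDerivWithinAt hcone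
  simp only [ContinuousLinearMap.toSpanSingleton_apply, smul_eq_mul, Pi.sub_apply] at hge
  have hpos : 0 < (F t₂ x₂ - ρ t₂) * (c * (F t₂ x₂ + ρ t₂) - C) :=
    mul_pos_of_neg_of_neg hFρ (by linarith [hbound t₂ ht₂ x₂])
  have hfin : 0 < Real.exp (-C * t₂) * (-C * 1) * (F t₂ x₂ - ρ t₂)
      + Real.exp (-C * t₂) * (r - c * ρ t₂ ^ 2) := by
    have : Real.exp (-C * t₂) * (-C * 1) * (F t₂ x₂ - ρ t₂)
      + Real.exp (-C * t₂) * (r - c * ρ t₂ ^ 2)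
      = Real.exp (-C * t₂) * (r - c * ρ t₂ ^ 2 - C * (F t₂ x₂ - ρ t₂)) := by ring
    rw [this]
    exact mul_pos (Real.exp_pos _) (by nlinarith)
  nlinarith

/-! ### Ricci flow on a closed manifold -/

section Flow

variable {n : ℕ} {M : Type*} [TopologicalSpace M] [ChartedSpace (Model n) M]
  [IsManifold (𝓡 n) ∞ M]

theorem continuousOn_scalarCurvature {J : Set ℝ} (hJ : UniqueDiffOn ℝ J) {g : ℝ → Metric n M}
    (hg : ∀ (p : M) (i j : Fin n),
      ContDiffOn ℝ ∞ (fun q : ℝ × Model n => (g q.1).coord p q.2 i j)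
        (J ×ˢ (extChartAt (𝓡 n) p).target)) :
    ContinuousOn (fun q : ℝ × M => (g q.1).scalarCurvature q.2) (J ×ˢ Set.univ) := by
  rintro ⟨t₀, x₀⟩ ⟨ht₀, -⟩
  have hsc := contDiffOn_scal (G := fun t => (g t).coord x₀) hJ (isOpen_extChartAt_target x₀)
    (hg x₀) fun t _ y hy => ((g t).coord_posDef x₀ hy).det_pos.ne'
  have h1 : ContinuousOn (fun q : ℝ × M => (q.1, extChartAt (𝓡 n) x₀ q.2))
      (J ×ˢ (extChartAt (𝓡 n) x₀).source) :=
    continuousOn_fst.prodMk ((continuousOn_extChartAt x₀).comp continuousOn_snd fun _ hq => hq.2)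
  have h2 := hsc.continuousOn.comp h1 fun q hq => ⟨hq.1, (extChartAt (𝓡 n) x₀).map_source hq.2⟩
  have h3 : ContinuousOn (fun q : ℝ × M => (g q.1).scalarCurvature q.2)
      (J ×ˢ (extChartAt (𝓡 n) x₀).source) := by
    refine h2.congr fun q hq => ?_
    exact (g q.1).scalarCurvature_eq
      (fun p i j => contDiffOn_slice (hg p i j) hq.1) x₀ hq.2
  refine (h3 (t₀, x₀) ⟨ht₀, mem_extChartAt_source x₀⟩).mono_of_mem_nhdsWithin ?_
  rw [nhdsWithin_prod_eq]
  exact Filter.prod_mem_prod self_mem_nhdsWithin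
    (mem_nhdsWithin_of_mem_nhds (extChartAt_source_mem_nhds x₀))

theorem contDiffOn_comp_snd {f : Model n → ℝ} {U : Set (Model n)} (hf : ContDiffOn ℝ ∞ f U) :
    ContDiffOn ℝ ∞ (fun q : ℝ × Model n => f q.2) (Set.univ ×ˢ U) :=
  hf.comp contDiff_snd.contDiffOn fun _ hq => hq.2

theorem continuous_scalarCurvature {g : Metric n M}
    (hg : ∀ (p : M) (i j : Fin n),
      ContDiffOn ℝ ∞ (fun y => g.coord p y i j) (extChartAt (𝓡 n) p).target) :
    Continuous fun x => g.scalarCurvature x := by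
  have h : ContinuousOn (fun q : ℝ × M => g.scalarCurvature q.2) (Set.univ ×ˢ Set.univ) :=
    continuousOn_scalarCurvature (g := fun _ => g) uniqueDiffOn_univ
      fun p i j => contDiffOn_comp_snd (hg p i j)
  rw [Set.univ_prod_univ, continuousOn_univ] at h
  have h2 : ∀ F : M → ℝ, (Continuous fun q : ℝ × M => F q.2) → Continuous F := fun F hF =>
    hF.comp (Continuous.prodMk_right (0 : ℝ))
  exact h2 _ h

/-- In the chart around x, R at x is by definition the coordinate expression at every time; chart
independence is needed only to see that x is a local minimum in coordinates. -/
theorem IsRicciFlow.deriv_scalarCurvature_at_min {J : Set ℝ} (hJ : UniqueDiffOn ℝ J)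
    (hJ' : J ⊆ closure (interior J)) {g : ℝ → Metric n M} (hg : IsRicciFlow J g) {t : ℝ}
    (ht : t ∈ J) {x : M} (hx : ∀ x', (g t).scalarCurvature x ≤ (g t).scalarCurvature x') :
    ∃ r, HasDerivWithinAt (fun s => (g s).scalarCurvature x) r J t
      ∧ 2 * (g t).scalarCurvature x ^ 2 ≤ n * r := by
  have hU := isOpen_extChartAt_target (I := 𝓡 n) x
  refine scal_evolution_at_min (G := fun t => (g t).coord x) hJ hJ' hU (hg.smooth x)
    (fun s _ y hy => (g s).coord_posDef x hy) (hg.evolution x) ht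
    (mem_extChartAt_target x) ?_
  filter_upwards [hU.mem_nhds (mem_extChartAt_target x)] with y hy
  have h1 := (g t).scalarCurvature_eq (fun p i j => contDiffOn_slice (hg.smooth p i j) ht) x
    ((extChartAt (𝓡 n) x).map_target hy)
  rw [(extChartAt (𝓡 n) x).right_inv hy] at h1
  rw [← h1]
  exact hx _

theorem IsRicciFlow.le_scalarCurvature [CompactSpace M] (hn : n ≠ 0) {J : Set ℝ}
    (hJ : J.OrdConnected) (h0 : 0 ∈ J) {g : ℝ → Metric n M} (hg : IsRicciFlow J g)
    {T : ℝ} (hT : T ∈ J) (hT0 : 0 ≤ T) {ρ : ℝ → ℝ}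
    (hρ : ∀ t ∈ Set.Icc 0 T, HasDerivAt ρ (2 / n * ρ t ^ 2) t)
    (hρ0 : ∀ x, ρ 0 ≤ (g 0).scalarCurvature x) (x : M) : ρ T ≤ (g T).scalarCurvature x := by
  -- The case T = 0 is separate because J may be just {0}, where derivatives within J are not
  -- unique. For T > 0 the interval J has interior points.
  rcases hT0.eq_or_lt with rfl | hTpos
  · exact hρ0 x
  have hsub : Set.Icc 0 T ⊆ J := hJ.out h0 hT
  have hint : (interior J).Nonempty :=
    ⟨T / 2, interior_mono hsub (by rw [interior_Icc]; constructor <;> linarith)⟩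
  have hJd : UniqueDiffOn ℝ J := uniqueDiffOn_convex hJ.convex hint
  have hJ' : J ⊆ closure (interior J) := by
    rw [(hJ.convex (𝕜 := ℝ)).closure_interior_eq_closure_of_nonempty_interior hint]
    exact subset_closure
  refine min_principle (F := fun t x => (g t).scalarCurvature x)
    ((continuousOn_scalarCurvature hJd hg.smooth).mono (Set.prod_mono hsub subset_rfl))
    (c := 2 / n) (fun t ht x hx => ?_) (fun t ht => (hρ t ht).hasDerivWithinAt) hρ0 T
    ⟨hT0, le_rfl⟩ x
  obtain ⟨r, hr, hle⟩ := hg.deriv_scalarCurvature_at_min hJd hJ' (hsub ht) hx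
  refine ⟨r, hr.mono hsub, ?_⟩
  have hnpos : (0 : ℝ) < n := Nat.cast_pos.2 (Nat.pos_of_ne_zero hn)
  rw [div_mul_eq_mul_div, div_le_iff₀ hnpos]
  linarith

theorem hasDerivAt_comparison {m N t : ℝ} (h : 1 / m - 2 * t / N ≠ 0) :
    HasDerivAt (fun s => (1 / m - 2 * s / N)⁻¹) (2 / N * ((1 / m - 2 * t / N)⁻¹) ^ 2) t := by
  have h1 : HasDerivAt (fun s => 1 / m - 2 * s / N) (-(2 * 1 / N)) t :=
    (((hasDerivAt_id t).const_mul 2).div_const N).const_sub _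
  refine (h1.inv h).congr_deriv ?_
  rw [inv_pow, neg_neg, mul_one, div_eq_mul_inv (2 / N)]

/-- A Ricci flow with positive scalar curvature becomes singular before the comparison solution
blows up. -/
theorem IsRicciFlow.comparison_pos [CompactSpace M] [Nonempty M] (hn : n ≠ 0) {J : Set ℝ}
    (hJ : J.OrdConnected) (h0 : IsLeast J 0) {g : ℝ → Metric n M} (hg : IsRicciFlow J g)
    {m : ℝ} (hm : 0 < m) (hm0 : ∀ x, m ≤ (g 0).scalarCurvature x) {t : ℝ} (ht : t ∈ J) :
    0 < 1 / m - 2 * t / n := by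
  by_contra hneg
  rw [not_lt] at hneg
  have hnpos : (0 : ℝ) < n := Nat.cast_pos.2 (Nat.pos_of_ne_zero hn)
  set N : ℝ := (n : ℝ)
  have ht0 : 0 ≤ t := h0.2 ht
  have htpos : 0 < t := by
    rcases ht0.eq_or_lt with rfl | h
    · have : 0 < 1 / m := by positivity
      simp at hneg; linarith [inv_pos.2 hm]
    · exact h
  have hsub : Set.Icc 0 t ⊆ J := hJ.out h0.1 ht
  have hint : (interior J).Nonempty :=
    ⟨t / 2, interior_mono hsub (by rw [interior_Icc]; constructor <;> linarith)⟩
  have hJd : UniqueDiffOn ℝ J := uniqueDiffOn_convex hJ.convex hint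
  obtain ⟨x⟩ := ‹Nonempty M›
  have hcont : ContinuousOn (fun s => (g s).scalarCurvature x) (Set.Icc 0 t) :=
    (continuousOn_scalarCurvature hJd hg.smooth).comp (f := fun s : ℝ => (s, x))
      (by fun_prop) fun s hs => ⟨hsub hs, trivial⟩
  obtain ⟨B, hB⟩ := isCompact_Icc.exists_bound_of_continuousOn hcont
  have hB' : ∀ s ∈ Set.Icc 0 t, (g s).scalarCurvature x ≤ B := fun s hs =>
    (le_abs_self _).trans (hB s hs)
  have hmB : m ≤ B := (hm0 x).trans (hB' 0 ⟨le_rfl, ht0⟩)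
  -- The time at which the comparison solution equals B + 1, where B bounds R at x on [0, t]. It
  -- comes before the blow-up time, hence before t, and contradicts the bound.
  set s : ℝ := N / 2 * (1 / m - 1 / (B + 1)) with hs
  have hBm : 1 / (B + 1) < 1 / m := one_div_lt_one_div_of_lt hm (by linarith)
  have hBpos : 0 < 1 / (B + 1) := by
    have : 0 < B + 1 := by linarith
    positivity
  have hs0 : 0 ≤ s := mul_nonneg (by positivity) (by linarith)
  have hds : 2 * s / N = 1 / m - 1 / (B + 1) := by
    rw [hs]; field_simp
  have hmono : ∀ a b : ℝ, 2 * a / N ≤ 2 * b / N ↔ a ≤ b := fun a b => by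
    rw [div_le_div_iff_of_pos_right hnpos]; constructor <;> intro h <;> linarith
  have hst : s ≤ t := by
    rw [← hmono, hds]; linarith
  have key := hg.le_scalarCurvature hn hJ h0.1 (hsub ⟨hs0, hst⟩) hs0
    (ρ := fun r => (1 / m - 2 * r / N)⁻¹)
    (fun r hr => hasDerivAt_comparison (by
      have := (hmono r s).2 hr.2
      rw [hds] at this
      have : 0 < 1 / m - 2 * r / N := by linarith
      exact this.ne'))
    (fun x => by simpa using hm0 x) x
  simp only [hds] at key
  rw [sub_sub_cancel, one_div, inv_inv] at key
  linarith [hB' s ⟨hs0, hst⟩]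

end Flow

end RicciFlow

end

theorem theorem4p12 (n : ℕ) (M : Type*) [TopologicalSpace M] [T2Space M] [CompactSpace M]
    [Nonempty M] [ChartedSpace (RicciFlow.Model n) M] [IsManifold (𝓡 n) ∞ M]
    (J : Set ℝ) (hJ : J.OrdConnected) (h0 : IsLeast J 0)
    (g : ℝ → RicciFlow.Metric n M) (hg : RicciFlow.IsRicciFlow J g) :
    ∃ m : ℝ, IsLeast (Set.range fun x : M => (g 0).scalarCurvature x) m ∧
      (m ≠ 0 → ∀ t ∈ J, ∀ x : M,
        1 / m - 2 * t / (n : ℝ) ≠ 0 ∧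
          (1 / m - 2 * t / (n : ℝ))⁻¹ ≤ (g t).scalarCurvature x) ∧
      (m = 0 → ∀ t ∈ J, ∀ x : M, 0 ≤ (g t).scalarCurvature x) := by
  have hc := RicciFlow.continuous_scalarCurvature (g := g 0)
    fun p i j => RicciFlow.contDiffOn_slice (hg.smooth p i j) h0.1
  obtain ⟨m, hm⟩ := (isCompact_range hc).exists_isLeast (Set.range_nonempty _)
  have hm0 : ∀ x, m ≤ (g 0).scalarCurvature x := fun x => hm.2 ⟨x, rfl⟩
  refine ⟨m, hm, ?_⟩
  -- In dimension 0 the quotient by n is the default value 0, but R is an empty sum, so m = 0 and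
  -- the case m ≠ 0 is void.
  rcases eq_or_ne n 0 with rfl | hn
  · have hR : ∀ t x, (g t).scalarCurvature x = 0 := fun t x => by
      simp [RicciFlow.Metric.scalarCurvature, RicciFlow.scal]
    refine ⟨fun hne => absurd ?_ hne, fun _ t _ x => (hR t x).ge⟩
    obtain ⟨x, hx⟩ := hm.1
    rw [← hx]
    exact hR 0 x
  refine ⟨fun hne t ht x => ?_, fun hz t ht x => ?_⟩
  -- The comparison solution must exist on all of [0, t], not only at t.
  · have hd : ∀ s ∈ Set.Icc 0 t, 1 / m - 2 * s / (n : ℝ) ≠ 0 := fun s hs => by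
      rcases hne.lt_or_gt with hlt | hgt
      · have h1 : 1 / m < 0 := one_div_neg.2 hlt
        have h2 : 0 ≤ 2 * s / (n : ℝ) :=
          div_nonneg (mul_nonneg two_pos.le hs.1) (Nat.cast_nonneg n)
        linarith
      · exact (hg.comparison_pos hn hJ h0 hgt hm0 (hJ.out h0.1 ht hs)).ne'
    exact ⟨hd t ⟨h0.2 ht, le_rfl⟩, hg.le_scalarCurvature hn hJ h0.1 ht (h0.2 ht)
      (ρ := fun s => (1 / m - 2 * s / (n : ℝ))⁻¹)
      (fun s hs => RicciFlow.hasDerivAt_comparison (hd s hs))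
      (fun x => by simpa using hm0 x) x⟩
  · exact hg.le_scalarCurvature hn hJ h0.1 ht (h0.2 ht) (ρ := fun _ => 0)
      (fun s _ => by simpa using hasDerivAt_const s (0 : ℝ)) (fun x => hz ▸ hm0 x) x
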